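/- **Setting.** An $L$-space is a set $X$ with a commutative associative addition having a neutral element $\theta$, a multiplication by real numbers with $\alpha(x+y)=\alpha x+\alpha y$, $\alpha(\beta x)=(\alpha\beta)x$, $1x=x$, $0x=\theta$, and a complete separable metric $h_X$ with $h_X(\alpha x,\alpha y)=|\alpha|h_X(x,y)$ and $h_X(x+z,y+z)\le h_X(x,y)$. An element $x$ is convex if $(\alpha+\beta)x=\alpha x+\beta x$ for all $\alpha,\beta\ge 0$; $X^{\rm c}$ is the set of convex elements. A convexifying operator is a surjective map $P\colon X\to X^{\rm c}$ with $h_X(P(x),P(y))\le h_X(x,y)$, $P\circ P=P$ and $P(\alpha x+\beta y)=\alpha P(x)+\beta P(y)$. Fix an $L$-space $X$ with a convexifying operator $P$, and $a<b$. The integral over $[a,b]$ of a simple function with values $x_i$ on disjoint measurable sets $T_i$ is $\sum_i\mu(T_i)P(x_i)$; the integral of $f$ is the limit of the integrals of simple functions $g_n$ such that $P\circ g_n\to P\circ f$ uniformly (almost everywhere) on $[a,b]$. A modulus of continuity is a non-decreasing continuous subadditive function $\omega$ on $[0,\infty)$ with $\omega(0)=0$. $H^\omega([a,b],X)$ is the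 class of all $f\colon[a,b]\to X$ with $h_X(f(t),f(s))\le\omega(|t-s|)$ for $s,t\in[a,b]$, and $$S(\psi_1,\psi_2)=\sup_{f\in H^\omega([a,b],X)}h_X\left(\int_a^b f(t)\psi_1(t)\,dt,\int_a^b f(t)\psi_2(t)\,dt\right).$$ $D_0[a,b]$ is the set of $\psi\colon[a,b]\to\mathbb R$ with finite one-sided limits at all points of $(a,b)$, finite limits $\psi(a+0)$, $\psi(b-0)$, and $\int_a^b\psi=0$. A hat-function on $[\alpha,\beta]$ ($\alpha<\beta$) is a continuous real function $\varphi$ on $[\alpha,\beta]$ with $\varphi(\alpha)=\varphi(\beta)=0$, $|\varphi|>0$ on $(\alpha,\beta)$, such that for $0<y<\max|\varphi|$ the equation $|\varphi(t)|=y$ has exactly two roots in $(\alpha,\beta)$; it is continued by $0$ to the line. It is strictly monotone on two intervals $(\alpha,\alpha')$ and $(\beta',\beta)$ and constant on $[\alpha',\beta']$. A $\Sigma$-representation of $f\colon[a,b]\to\mathbb R$ is a finite or countable family of hat-functions $\varphi_k$ on segments $[\alpha_k,\beta_k]\subset[a,b]$ with $f=\sum_k\varphi_k$ and $|f|=\sum_k|\varphi_k|$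 on $[a,b]$, such that the intervals $(\alpha_k,\alpha_k')$, $(\beta_k',\beta_k)$ (over all $k$) are pairwise disjoint and, for each $k$, $\varphi_k=f+c_k$ on both intervals of $\varphi_k$ with a constant $c_k$. The Korneichuk $\Sigma$-rearrangement of $f$ is $$R(f;t)=\sum_k r(|\varphi_k|,t),\quad 0\le t\le b-a,\qquad r(g,t)=\inf\{y\ge 0:\ \mathrm{mes}\{s\in[a,b]:g(s)>y\}\le t\}.$$ **Theorem.** Let $\omega$ be a concave modulus of continuity and let $\psi_1,\psi_2\colon[a,b]\to\mathbb R$ be bounded, measurable and non-negative almost everywhere, with $\psi_1-\psi_2\in D_0[a,b]$. Set $\Psi(t)=\int_a^t(\psi_1(u)-\psi_2(u))\,du$. Then the integrals in the definition of $S(\psi_1,\psi_2)$ exist, $\Psi$ has a $\Sigma$-representation, and, with $R(\Psi;\cdot)$ computed from any $\Sigma$-representation of $\Psi$, $$S(\psi_1,\psi_2)\le\int_0^{b-a}|R'(\Psi;t)|\,\omega(t)\,dt.$$ -/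

import Mathlib

open Set Filter Topology MeasureTheory

open scoped ENNReal

/-- `L`-spaces: complete separable metric spaces with an addition and a multiplication by real
numbers.  The laws `x + y = y + x`, `x + (y + z) = (x + y) + z`, `x + θ = x` (with `θ = 0`),
`α (x + y) = α x + α y`, `α (β x) = (α β) x`, `1 x = x` are those of `AddCommMonoid` and
`DistribMulAction`; its further law `α θ = θ` follows from them and `0 x = θ`.  The law
`(α + β) x = α x + β x` is not assumed. -/
class IsLSpace (X : Type*) [AddCommMonoid X] [DistribMulAction ℝ X] [MetricSpace X] : Prop where
  complete : CompleteSpace X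
  separable : TopologicalSpace.SeparableSpace X
  zero_smul : ∀ x : X, (0 : ℝ) • x = 0
  dist_smul : ∀ (α : ℝ) (x y : X), dist (α • x) (α • y) = |α| * dist x y
  dist_add_le : ∀ x y z : X, dist (x + z) (y + z) ≤ dist x y

/-- The set `X^c` of convex elements. -/
def convexElements (X : Type*) [AddCommMonoid X] [DistribMulAction ℝ X] : Set X :=
  {x | ∀ α β : ℝ, 0 ≤ α → 0 ≤ β → (α + β) • x = α • x + β • x}

/-- Convexifying operators `P : X → X^c` (surjective onto `X^c`). -/
structure IsConvexifying {X : Type*} [AddCommMonoid X] [DistribMulAction ℝ X] [MetricSpace X]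
    (P : X → X) : Prop where
  range_eq : Set.range P = convexElements X
  dist_le : ∀ x y : X, dist (P x) (P y) ≤ dist x y
  idem : ∀ x : X, P (P x) = P x
  map_add_smul : ∀ (α β : ℝ) (x y : X), P (α • x + β • y) = α • P x + β • P y

/-- The integral `∑ μ(T_i) P(x_i)` over `[a,b]` of a mapping with finitely many values `x_i`
on measurable sets `T_i`. -/
noncomputable def simpleLIntegral {X : Type*} [AddCommMonoid X] [DistribMulAction ℝ X]
    (P : X → X) (a b : ℝ) (g : SimpleFunc ℝ X) : X :=
  ∑ x ∈ g.range, (volume.real ((g ⁻¹' {x}) ∩ Icc a b)) • P x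

/-- `I` is the Lebesgue integral of `f` over `[a,b]`: the limit of the integrals of simple
mappings which approximate `f` uniformly (off null sets, so that Lebesgue measurable functions
are covered by Borel simple mappings).  Uniform closeness is tested after applying the
`1`-Lipschitz map `P`, so every sequence of simple mappings that converges to `f` uniformly is
admissible; the integral of `f` is that of `P ∘ f`. -/
def HasLIntegral {X : Type*} [AddCommMonoid X] [DistribMulAction ℝ X] [MetricSpace X]
    (P : X → X) (a b : ℝ) (f : ℝ → X) (I : X) : Prop :=
  ∃ g : ℕ → SimpleFunc ℝ X,
    (∀ ε : ℝ, 0 < ε → ∀ᶠ n in atTop, ∀ᵐ t ∂(volume.restrict (Icc a b)),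
      dist (P (g n t)) (P (f t)) ≤ ε) ∧
    Tendsto (fun n => simpleLIntegral P a b (g n)) atTop (𝓝 I)

/-- The integral of `f` over `[a,b]` exists. -/
def LIntegrable {X : Type*} [AddCommMonoid X] [DistribMulAction ℝ X] [MetricSpace X]
    (P : X → X) (a b : ℝ) (f : ℝ → X) : Prop :=
  ∃ I : X, HasLIntegral P a b f I

open Classical in
/-- The integral `∫_a^b f(t) dt` in an `L`-space (`θ` if it does not exist). -/
noncomputable def lIntegral {X : Type*} [AddCommMonoid X] [DistribMulAction ℝ X] [MetricSpace X]
    (P : X → X) (a b : ℝ) (f : ℝ → X) : X :=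
  if h : LIntegrable P a b f then h.choose else 0

/-- Moduli of continuity. -/
structure IsModulusOfContinuity (ω : ℝ → ℝ) : Prop where
  map_zero : ω 0 = 0
  continuousOn : ContinuousOn ω (Ici 0)
  monotoneOn : MonotoneOn ω (Ici 0)
  subadditive : ∀ s t : ℝ, 0 ≤ s → 0 ≤ t → ω (s + t) ≤ ω s + ω t

/-- The class `H^ω([a,b], X)` (only the values on `[a,b]` matter). -/
def classH {X : Type*} [MetricSpace X] (ω : ℝ → ℝ) (a b : ℝ) : Set (ℝ → X) :=
  {f | ∀ s ∈ Icc a b, ∀ t ∈ Icc a b, dist (f s) (f t) ≤ ω |s - t|}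

/-- The functional `S(ψ₁, ψ₂)`, a supremum in `[0, ∞]`. -/
noncomputable def functionalS {X : Type*} [AddCommMonoid X] [DistribMulAction ℝ X]
    [MetricSpace X] (P : X → X) (ω : ℝ → ℝ) (a b : ℝ) (ψ₁ ψ₂ : ℝ → ℝ) : ℝ≥0∞ :=
  ⨆ f ∈ (classH ω a b : Set (ℝ → X)),
    edist (lIntegral P a b (fun t => ψ₁ t • f t)) (lIntegral P a b (fun t => ψ₂ t • f t))

/-- `ψ ∈ B([a,b], ℝ)`: bounded and Lebesgue measurable on `[a,b]`. -/
structure IsBoundedMeasurable (a b : ℝ) (ψ : ℝ → ℝ) : Prop where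
  aemeasurable : AEMeasurable ψ (volume.restrict (Icc a b))
  bounded : ∃ M : ℝ, ∀ t ∈ Icc a b, |ψ t| ≤ M

/-- `ψ ∈ D₀[a,b]`: finite one-sided limits at all points of `(a,b)`, a finite right limit at `a`
and a finite left limit at `b`, and mean value zero. -/
structure IsD0 (a b : ℝ) (ψ : ℝ → ℝ) : Prop where
  right_limit : ∀ t ∈ Ico a b, ∃ l : ℝ, Tendsto ψ (𝓝[>] t) (𝓝 l)
  left_limit : ∀ t ∈ Ioc a b, ∃ l : ℝ, Tendsto ψ (𝓝[<] t) (𝓝 l)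
  integral_eq_zero : ∫ t in a..b, ψ t = 0

/-- Hat-functions on `[α,β]`, continued by zero to the line. -/
structure IsHatFunction (α β : ℝ) (φ : ℝ → ℝ) : Prop where
  lt : α < β
  continuousOn : ContinuousOn φ (Icc α β)
  eq_zero : ∀ t, t ∉ Ioo α β → φ t = 0
  abs_pos : ∀ t ∈ Ioo α β, 0 < |φ t|
  two_roots : ∀ y : ℝ, 0 < y → y < sSup ((fun t => |φ t|) '' Icc α β) →
    {t | t ∈ Ioo α β ∧ |φ t| = y}.ncard = 2

/-- `(α,α')` and `(β',β)` are the intervals on which the hat-function `φ` on `[α,β]` is strictly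
monotone: `|φ|` increases on the first one, decreases on the second one, and `φ` is constant
in between. -/
structure IsHatWithIntervals (α α' β' β : ℝ) (φ : ℝ → ℝ) : Prop where
  isHat : IsHatFunction α β φ
  lt_left : α < α'
  le_mid : α' ≤ β'
  lt_right : β' < β
  strictMonoOn : StrictMonoOn (fun t => |φ t|) (Icc α α')
  const : ∀ t ∈ Icc α' β', φ t = φ α'
  strictAntiOn : StrictAntiOn (fun t => |φ t|) (Icc β' β)

/-- `f = ∑ φ_k` on `[a,b]` is a `Σ`-representation of `f`: the `φ_k` are hat-functions on segments
contained in `[a,b]`, `|f| = ∑ |φ_k|`, the intervals of strict monotonicity of all the `φ_k` are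
pairwise disjoint, and on the two intervals of `φ_k` one has `φ_k = f + c_k`.  (The formulas
`f' = ∑ φ_k'` a.e., `∫ |f| = ∑ ∫ |φ_k|` and `Var f = ∑ Var φ_k` follow for Lipschitz `f`.) -/
def IsSigmaRepresentation (a b : ℝ) (f : ℝ → ℝ) {ι : Type} (φ : ι → ℝ → ℝ) : Prop :=
  ∃ α α' β' β : ι → ℝ,
    (∀ k, a ≤ α k ∧ β k ≤ b ∧ IsHatWithIntervals (α k) (α' k) (β' k) (β k) (φ k)) ∧
    (∀ t ∈ Icc a b, HasSum (fun k => φ k t) (f t)) ∧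
    (∀ t ∈ Icc a b, HasSum (fun k => |φ k t|) |f t|) ∧
    (Pairwise fun p q : ι × Bool =>
      Disjoint
        (if p.2 then Ioo (α p.1) (α' p.1) else Ioo (β' p.1) (β p.1))
        (if q.2 then Ioo (α q.1) (α' q.1) else Ioo (β' q.1) (β q.1))) ∧
    (∀ k, ∃ c : ℝ, ∀ t ∈ Ioo (α k) (α' k) ∪ Ioo (β' k) (β k), φ k t = f t + c)

/-- The distribution function `m(g, y)` of `g` on `[a,b]`. -/
noncomputable def distributionFunction (a b : ℝ) (g : ℝ → ℝ) (y : ℝ) : ℝ :=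
  volume.real {t | t ∈ Icc a b ∧ y < g t}

/-- The non-increasing rearrangement `r(g, t)` of a non-negative function `g` on `[a,b]`.
(For `t < b - a` the restriction `0 ≤ y` changes nothing.) -/
noncomputable def rearrangement (a b : ℝ) (g : ℝ → ℝ) (t : ℝ) : ℝ :=
  sInf {y | 0 ≤ y ∧ distributionFunction a b g y ≤ t}

/-- The Korneichuk `Σ`-rearrangement `R(f; t) = ∑ r(|φ_k|, t)` of a function on `[a,b]` with
`Σ`-representation `f = ∑ φ_k`. -/
noncomputable def sigmaRearrangement (a b : ℝ) {ι : Type} (φ : ι → ℝ → ℝ) (t : ℝ) : ℝ :=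
  ∑' k, rearrangement a b (fun s => |φ k s|) t

/-! The proof reduces to real-valued `f` and then decomposes `∫ f ψ`, with `ψ = ψ₁ - ψ₂`, hat by
hat.

Reduction. On convex elements the metric is translation invariant, so formal real combinations of
the elements `P x` carry a seminorm-like gauge `combDist`. A linear functional dominated by it
(Hahn-Banach) gives an additive, positively homogeneous `η` on `X` that is 1-Lipschitz for `dist (P
x) (P y)` and attains a prescribed distance (`IsConvexifying.exists_functional`). Such an `η`
commutes with the integral, and since both weights are non-negative, the distance of the two
integrals equals `∫ (η ∘ f) ψ`. The function `η ∘ f` again has `ω` as a modulus.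

Real estimate. The monotonicity intervals of the hats are disjoint, and `ψ` vanishes almost
everywhere outside them, so `∫ f ψ` is the sum of the integrals over these intervals. For one hat,
let `l y < ρ y` be the two points at height `y`. Substituting `y = |φ t|` turns its contribution
into at most `∫ ω (ρ y - l y) dy`. The rearrangement of the hat is inverse to `ρ - l`, so a second
substitution gives `∫ -r'(t) ω t dt` (`integral_mul_le_of_hat`). Any finite sum of the `-r'` is at
most `|R'|` almost everywhere, because the omitted terms sum to a decreasing function.

Existence of the representation. One-sided limits of `ψ` yield a Sard-type statement: `Ψ` maps the
closure of its local extrema to a closed null set of levels. Over each gap `(p, q)` between these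
levels, every component of `{Ψ > p}` carries the hat `min Ψ q - p`. The hats add up to the positive
part of `Ψ` by the layer-cake formula, and `-Ψ` supplies the negative part. -/

/-! ### Change of variables and inverses of monotone functions -/

/-- Change of variables `y = h t` for Lipschitz `h` and bounded continuous `u`. -/
theorem integral_comp_mul_of_lipschitzOn {h g u : ℝ → ℝ} {c d : ℝ} {K : NNReal} (hcd : c ≤ d)
    (hL : LipschitzOnWith K h (Icc c d)) (hg : ∀ᵐ t, t ∈ Ioo c d → HasDerivAt h (g t) t)
    (hu : Continuous u) {C : ℝ} (hC : ∀ y, |u y| ≤ C) :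
    ∫ t in c..d, u (h t) * g t = ∫ y in h c..h d, u y := by
  -- Since `u` is bounded, its antiderivative `U` is Lipschitz. So `U ∘ h` is absolutely continuous,
  -- and the fundamental theorem needs the derivative of `h` only almost everywhere.
  set U : ℝ → ℝ := fun y => ∫ x in (0 : ℝ)..y, u x with hU
  have hUd : ∀ y, HasDerivAt U (u y) y := fun y =>
    intervalIntegral.integral_hasDerivAt_right (hu.intervalIntegrable _ _)
      hu.aestronglyMeasurable.stronglyMeasurableAtFilter hu.continuousAt
  have hUsub : ∀ x y, U y - U x = ∫ z in x..y, u z := fun x y =>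
    intervalIntegral.integral_interval_sub_left (hu.intervalIntegrable _ _)
      (hu.intervalIntegrable _ _)
  have hC0 : 0 ≤ C := (abs_nonneg _).trans (hC 0)
  have hUL : LipschitzWith C.toNNReal U := by
    apply LipschitzWith.of_dist_le_mul
    intro x y
    rw [Real.coe_toNNReal _ hC0, dist_comm, Real.dist_eq, Real.dist_eq, hUsub, abs_sub_comm]
    exact intervalIntegral.norm_integral_le_of_norm_le_const (f := u) fun z _ => hC z
  have hac : AbsolutelyContinuousOnInterval (fun t => U (h t)) c d := by
    apply LipschitzOnWith.absolutelyContinuousOnInterval (K := C.toNNReal * K)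
    rw [uIcc_of_le hcd]
    exact hUL.comp_lipschitzOnWith hL
  rw [← hUsub, ← hac.integral_deriv_eq_sub]
  apply intervalIntegral.integral_congr_ae
  have hne : ∀ᵐ t : ℝ, t ≠ d := by simp [ae_iff, measure_singleton]
  filter_upwards [hg, hne] with t ht htd hmem
  rw [uIoc_of_le hcd] at hmem
  have := (hUd (h t)).comp t (ht ⟨hmem.1, lt_of_le_of_ne hmem.2 htd⟩)
  exact this.deriv.symm

/-- A strictly increasing continuous function on a segment has a continuous inverse, extended by
constants to the line. -/
theorem StrictMonoOn.exists_continuous_inverse {h : ℝ → ℝ} {c d : ℝ} (hcd : c ≤ d)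
    (hm : StrictMonoOn h (Icc c d)) (hc : ContinuousOn h (Icc c d)) :
    ∃ l : ℝ → ℝ, Continuous l ∧ (∀ y, l y ∈ Icc c d) ∧ (∀ t ∈ Icc c d, l (h t) = t) ∧
      ∀ y ∈ Icc (h c) (h d), h (l y) = y := by
  have hle : h c ≤ h d := hm.monotoneOn (left_mem_Icc.2 hcd) (right_mem_Icc.2 hcd) hcd
  have hex : ∀ y : ℝ, ∃ t : Icc c d, h t = max (h c) (min (h d) y) := by
    intro y
    obtain ⟨t, ht, hty⟩ := intermediate_value_Icc hcd hc
      (show max (h c) (min (h d) y) ∈ Icc (h c) (h d) from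
        ⟨le_max_left _ _, max_le hle (min_le_left _ _)⟩)
    exact ⟨⟨t, ht⟩, hty⟩
  choose l hl using hex
  have hinv : ∀ t (ht : t ∈ Icc c d), l (h t) = ⟨t, ht⟩ := by
    intro t ht
    apply Subtype.ext
    apply hm.injOn (l (h t)).2 ht
    rw [hl, min_eq_right (hm.monotoneOn ht (right_mem_Icc.2 hcd) ht.2),
      max_eq_right (hm.monotoneOn (left_mem_Icc.2 hcd) ht ht.1)]
  have hmono : Monotone l := by
    intro y z hyz
    rw [← Subtype.coe_le_coe, ← hm.le_iff_le (l y).2 (l z).2, hl, hl]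
    exact max_le_max le_rfl (min_le_min le_rfl hyz)
  have hsurj : Function.Surjective l := fun t => ⟨h t, hinv t t.2⟩
  have hcont : Continuous l := hmono.continuous_of_surjective hsurj
  refine ⟨fun y => l y, continuous_subtype_val.comp hcont, fun y => (l y).2, fun t ht => ?_,
    fun y hy => ?_⟩
  · exact congrArg Subtype.val (hinv t ht)
  · rw [hl, min_eq_right hy.2, max_eq_right hy.1]

theorem StrictAntiOn.exists_continuous_inverse {h : ℝ → ℝ} {c d : ℝ} (hcd : c ≤ d)
    (hm : StrictAntiOn h (Icc c d)) (hc : ContinuousOn h (Icc c d)) :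
    ∃ l : ℝ → ℝ, Continuous l ∧ (∀ y, l y ∈ Icc c d) ∧ (∀ t ∈ Icc c d, l (h t) = t) ∧
      ∀ y ∈ Icc (h d) (h c), h (l y) = y := by
  obtain ⟨l, h1, h2, h3, h4⟩ := StrictMonoOn.exists_continuous_inverse (h := fun t => -h t) hcd
    (fun x hx y hy hxy => neg_lt_neg (hm hx hy hxy)) hc.neg
  refine ⟨fun y => l (-y), h1.comp continuous_neg, fun y => h2 _, h3, fun y hy => ?_⟩
  have := h4 (-y) ⟨neg_le_neg hy.2, neg_le_neg hy.1⟩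
  linarith

/-! ### Rearrangement of a single hat -/

theorem distributionFunction_eq_zero {a b H y : ℝ} {g : ℝ → ℝ} (hg : ∀ t, g t ≤ H) (hy : H ≤ y) :
    distributionFunction a b g y = 0 := by
  have : {t | t ∈ Icc a b ∧ y < g t} = ∅ := by
    ext t
    simp only [mem_ofPred_eq, mem_empty_iff_false, iff_false, not_and, not_lt]
    exact fun _ => (hg t).trans hy
  rw [distributionFunction, this, measureReal_empty]

theorem rearrangement_nonneg (a b : ℝ) (g : ℝ → ℝ) (t : ℝ) : 0 ≤ rearrangement a b g t :=
  Real.sInf_nonneg fun _ hy => hy.1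

theorem rearrangement_le {a b H : ℝ} {g : ℝ → ℝ} (hH : 0 ≤ H) (hg : ∀ t, g t ≤ H) {t : ℝ}
    (ht : 0 ≤ t) : rearrangement a b g t ≤ H :=
  csInf_le ⟨0, fun _ hy => hy.1⟩ ⟨hH, by rwa [distributionFunction_eq_zero hg le_rfl]⟩

theorem rearrangement_antitoneOn {a b H : ℝ} {g : ℝ → ℝ} (hH : 0 ≤ H) (hg : ∀ t, g t ≤ H) :
    AntitoneOn (rearrangement a b g) (Ici 0) := by
  intro s hs t _ hst
  apply csInf_le_csInf ⟨0, fun _ hy => hy.1⟩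
  · exact ⟨H, hH, by rw [distributionFunction_eq_zero hg le_rfl]; exact hs⟩
  · exact fun y hy => ⟨hy.1, hy.2.trans hst⟩

theorem le_apply_of_hat {α α' β' β : ℝ} {h : ℝ → ℝ} (h1 : α < α') (h2 : α' ≤ β') (h3 : β' < β)
    (h0 : ∀ t, t ∉ Ioo α β → h t = 0) (hmono : StrictMonoOn h (Icc α α'))
    (hconst : ∀ t ∈ Icc α' β', h t = h α') (hanti : StrictAntiOn h (Icc β' β)) (t : ℝ) :
    h t ≤ h α' := by
  by_cases ht : t ∈ Ioo α β
  · rcases le_total t α' with ht1 | ht1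
    · exact hmono.monotoneOn ⟨ht.1.le, ht1⟩ ⟨h1.le, le_rfl⟩ ht1
    rcases le_total t β' with ht2 | ht2
    · exact (hconst t ⟨ht1, ht2⟩).le
    · rw [← hconst β' ⟨h2, le_rfl⟩]
      exact hanti.antitoneOn ⟨le_rfl, h3.le⟩ ⟨ht2, ht.2.le⟩ ht2
  · rw [h0 t ht, ← h0 α (by simp)]
    exact hmono.monotoneOn ⟨le_rfl, h1.le⟩ ⟨h1.le, le_rfl⟩ h1.le

/-- The inverses `l`, `ρ` of the two monotone parts of a non-negative hat function `h`: the
rearrangement of `h` is inverse to `ρ - l`. -/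
theorem exists_rearrangement_hat_inverse {a b α α' β' β : ℝ} {h : ℝ → ℝ} (haα : a ≤ α)
    (hβb : β ≤ b) (h1 : α < α') (h2 : α' ≤ β') (h3 : β' < β) (h0 : ∀ t, t ∉ Ioo α β → h t = 0)
    (hc : ContinuousOn h (Icc α β)) (hmono : StrictMonoOn h (Icc α α'))
    (hconst : ∀ t ∈ Icc α' β', h t = h α') (hanti : StrictAntiOn h (Icc β' β)) :
    ∃ l ρ : ℝ → ℝ, Continuous l ∧ Continuous ρ ∧ (∀ y, l y ∈ Icc α α') ∧
      (∀ y, ρ y ∈ Icc β' β) ∧ (∀ t ∈ Icc α α', l (h t) = t) ∧ (∀ t ∈ Icc β' β, ρ (h t) = t) ∧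
      (∀ y ∈ Icc 0 (h α'), h (l y) = y) ∧ (∀ y ∈ Icc 0 (h α'), h (ρ y) = y) ∧
      ∀ y ∈ Icc 0 (h α'), rearrangement a b h (ρ y - l y) = y := by
  have hα : h α = 0 := h0 _ (by simp)
  have hβ : h β = 0 := h0 _ (by simp)
  have hβ' : h β' = h α' := hconst _ ⟨h2, le_rfl⟩
  obtain ⟨l, l1, l2, l3, l4⟩ := hmono.exists_continuous_inverse h1.le
    (hc.mono (Icc_subset_Icc le_rfl (by linarith)))
  obtain ⟨ρ, r1, r2, r3, r4⟩ := hanti.exists_continuous_inverse h3.le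
    (hc.mono (Icc_subset_Icc (by linarith) le_rfl))
  rw [hα] at l4
  rw [hβ, hβ'] at r4
  have hle : ∀ t, h t ≤ h α' := le_apply_of_hat h1 h2 h3 h0 hmono hconst hanti
  have hset : ∀ y ∈ Ico 0 (h α'), {t | t ∈ Icc a b ∧ y < h t} = Ioo (l y) (ρ y) := by
    intro y hy
    have hy' : y ∈ Icc 0 (h α') := Ico_subset_Icc_self hy
    ext t
    simp only [mem_ofPred_eq]
    constructor
    · rintro ⟨-, ht⟩
      have htI : t ∈ Ioo α β := by
        by_contra hn
        rw [h0 t hn] at ht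
        exact absurd ht hy.1.not_gt
      constructor
      · by_contra! hn
        have := hmono.monotoneOn ⟨htI.1.le, hn.trans (l2 y).2⟩ (l2 y) hn
        rw [l4 y hy'] at this
        linarith
      · by_contra! hn
        have := hanti.antitoneOn (r2 y) ⟨(r2 y).1.trans hn, htI.2.le⟩ hn
        rw [r4 y hy'] at this
        linarith
    · rintro ⟨ht1, ht2⟩
      have htI : t ∈ Icc α β := ⟨(l2 y).1.trans ht1.le, ht2.le.trans (r2 y).2⟩
      refine ⟨⟨haα.trans htI.1, htI.2.trans hβb⟩, ?_⟩
      rcases le_total t α' with h4 | h4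
      · have := hmono (l2 y) ⟨htI.1, h4⟩ ht1
        rwa [l4 y hy'] at this
      rcases le_total t β' with h5 | h5
      · rw [hconst t ⟨h4, h5⟩]; exact hy.2
      · have := hanti ⟨h5, htI.2⟩ (r2 y) ht2
        rwa [r4 y hy'] at this
  have hlρ : ∀ y, l y ≤ ρ y := fun y => (l2 y).2.trans (h2.trans (r2 y).1)
  have hdist : ∀ y ∈ Ico 0 (h α'), distributionFunction a b h y = ρ y - l y := by
    intro y hy
    rw [distributionFunction, hset y hy, Measure.real, Real.volume_Ioo,
      ENNReal.toReal_ofReal (sub_nonneg.2 (hlρ y))]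
  refine ⟨l, ρ, l1, r1, l2, r2, l3, r3, l4, r4, fun y hy => ?_⟩
  -- The distribution function is `ρ - l`, strictly decreasing, below the maximum and zero from
  -- there on. So the admissible levels are exactly those from `y` upwards.
  have key : {z | 0 ≤ z ∧ distributionFunction a b h z ≤ ρ y - l y} = Ici y := by
    ext z
    simp only [mem_ofPred_eq, mem_Ici]
    constructor
    · rintro ⟨hz0, hz⟩
      by_contra! hzy
      have hzH : z ∈ Ico 0 (h α') := ⟨hz0, hzy.trans_le hy.2⟩
      rw [hdist z hzH] at hz
      have e1 : l z < l y := by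
        rw [← hmono.lt_iff_lt (l2 z) (l2 y), l4 y hy, l4 z (Ico_subset_Icc_self hzH)]
        exact hzy
      have e2 : ρ y < ρ z := by
        rw [← hanti.lt_iff_gt (r2 z) (r2 y), r4 y hy, r4 z (Ico_subset_Icc_self hzH)]
        exact hzy
      linarith
    · intro hz
      refine ⟨hy.1.trans hz, ?_⟩
      by_cases hzH : z < h α'
      · have hzH' : z ∈ Ico 0 (h α') := ⟨hy.1.trans hz, hzH⟩
        rw [hdist z hzH']
        have e1 : l y ≤ l z := by
          rw [← hmono.le_iff_le (l2 y) (l2 z), l4 y hy, l4 z (Ico_subset_Icc_self hzH')]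
          exact hz
        have e2 : ρ z ≤ ρ y := by
          rw [← hanti.le_iff_ge (r2 y) (r2 z), r4 y hy, r4 z (Ico_subset_Icc_self hzH')]
          exact hz
        linarith
      · rw [distributionFunction_eq_zero hle (not_lt.1 hzH)]
        exact sub_nonneg.2 (hlρ y)
  rw [rearrangement, key, csInf_Ici]

/-! ### The integral estimate for one hat -/

theorem IsModulusOfContinuity.nonneg {ω : ℝ → ℝ} (hω : IsModulusOfContinuity ω) {t : ℝ}
    (ht : 0 ≤ t) : 0 ≤ ω t := by
  have := hω.monotoneOn (mem_Ici.2 le_rfl) (mem_Ici.2 ht) ht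
  rwa [hω.map_zero] at this

theorem IsModulusOfContinuity.continuousOn_of_dist_le {Y : Type*} [PseudoMetricSpace Y] {ω : ℝ → ℝ}
    (hω : IsModulusOfContinuity ω) {s : Set ℝ} {f : ℝ → Y}
    (hf : ∀ x ∈ s, ∀ y ∈ s, dist (f x) (f y) ≤ ω |x - y|) : ContinuousOn f s := by
  intro x hx
  rw [ContinuousWithinAt, tendsto_iff_dist_tendsto_zero]
  have h1 : Tendsto (fun y => ω |y - x|) (𝓝 x) (𝓝 0) := by
    have h2 : Continuous fun y => ω |y - x| :=
      hω.continuousOn.comp_continuous (by fun_prop) fun y => mem_Ici.2 (abs_nonneg _)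
    simpa [hω.map_zero] using h2.tendsto x
  apply squeeze_zero' (Eventually.of_forall fun _ => dist_nonneg) _ (h1.mono_left nhdsWithin_le_nhds)
  filter_upwards [self_mem_nhdsWithin] with y hy using hf y hy x hx

theorem deriv_nonpos_of_antitoneOn_Ici {r : ℝ → ℝ} (hr : AntitoneOn r (Ici 0)) {t : ℝ}
    (ht : 0 < t) : deriv r t ≤ 0 := by
  rw [← derivWithin_of_mem_nhds (Ici_mem_nhds ht)]
  exact hr.derivWithin_nonpos

/-- The derivative of a monotone function is integrable on a compact interval even without absolute
continuity, and the factor `ω` is continuous there. -/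
theorem intervalIntegrable_deriv_mul {r ω : ℝ → ℝ} {T : ℝ} (hT : 0 ≤ T)
    (hr : AntitoneOn r (Ici 0)) (hω : ContinuousOn ω (Ici 0)) :
    IntervalIntegrable (fun t => deriv r t * ω t) volume 0 T := by
  have h1 : IntervalIntegrable (deriv r) volume 0 T := by
    have h2 : MonotoneOn (fun t => -r t) (uIcc 0 T) := by
      rw [uIcc_of_le hT]
      exact (hr.mono Icc_subset_Ici_self).neg
    have h3 := h2.intervalIntegrable_deriv.neg
    simpa [deriv.fun_neg, Pi.neg_def] using h3
  apply h1.mul_continuousOn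
  rw [uIcc_of_le hT]
  exact hω.mono Icc_subset_Ici_self

/-- The estimate for a single non-negative hat function. -/
theorem integral_mul_le_of_hat {a b α α' β' β : ℝ} {h ψ f ω : ℝ → ℝ} {K : NNReal} (haα : a ≤ α)
    (hβb : β ≤ b) (h1 : α < α') (h2 : α' ≤ β') (h3 : β' < β) (h0 : ∀ t, t ∉ Ioo α β → h t = 0)
    (hc : ContinuousOn h (Icc α β)) (hmono : StrictMonoOn h (Icc α α'))
    (hconst : ∀ t ∈ Icc α' β', h t = h α') (hanti : StrictAntiOn h (Icc β' β))
    (hL₁ : LipschitzOnWith K h (Icc α α')) (hL₂ : LipschitzOnWith K h (Icc β' β))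
    (hd₁ : ∀ᵐ t, t ∈ Ioo α α' → HasDerivAt h (ψ t) t)
    (hd₂ : ∀ᵐ t, t ∈ Ioo β' β → HasDerivAt h (ψ t) t)
    (hω : IsModulusOfContinuity ω)
    (hf : ∀ s ∈ Icc a b, ∀ t ∈ Icc a b, |f s - f t| ≤ ω |s - t|) :
    (∫ t in α..α', f t * ψ t) + (∫ t in β'..β, f t * ψ t) ≤
      ∫ t in (0 : ℝ)..(b - a), -deriv (rearrangement a b h) t * ω t := by
  obtain ⟨l, ρ, l1, r1, l2, r2, l3, r3, l4, r4, hr⟩ :=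
    exists_rearrangement_hat_inverse haα hβb h1 h2 h3 h0 hc hmono hconst hanti
  have hα : h α = 0 := h0 _ (by simp)
  have hβ : h β = 0 := h0 _ (by simp)
  have hβ' : h β' = h α' := hconst _ ⟨h2, le_rfl⟩
  set H := h α'
  have hH : 0 < H := hα ▸ hmono ⟨le_rfl, h1.le⟩ ⟨h1.le, le_rfl⟩ h1
  have hle : ∀ t, h t ≤ H := le_apply_of_hat h1 h2 h3 h0 hmono hconst hanti
  have hsub₁ : ∀ y, l y ∈ Icc a b := fun y => ⟨haα.trans (l2 y).1, by linarith [(l2 y).2]⟩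
  have hsub₂ : ∀ y, ρ y ∈ Icc a b := fun y => ⟨by linarith [(r2 y).1], (r2 y).2.trans hβb⟩
  have hfc : ContinuousOn f (Icc a b) := hω.continuousOn_of_dist_le hf
  obtain ⟨C, hC⟩ := isCompact_Icc.exists_bound_of_continuousOn hfc
  have hfl : Continuous fun y => f (l y) := hfc.comp_continuous l1 hsub₁
  have hfρ : Continuous fun y => f (ρ y) := hfc.comp_continuous r1 hsub₂
  have e1 : ∫ t in α..α', f t * ψ t = ∫ y in (0 : ℝ)..H, f (l y) := by
    have := integral_comp_mul_of_lipschitzOn h1.le hL₁ hd₁ hfl (fun y => hC _ (hsub₁ y))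
    rw [hα] at this
    rw [← this]
    apply intervalIntegral.integral_congr
    intro t ht
    rw [uIcc_of_le h1.le] at ht
    simp only [l3 t ht]
  -- On this side `h` runs from `H` down to `0`, which produces the minus sign and hence the
  -- difference `f (l y) - f (ρ y)`.
  have e2 : ∫ t in β'..β, f t * ψ t = -∫ y in (0 : ℝ)..H, f (ρ y) := by
    have := integral_comp_mul_of_lipschitzOn h3.le hL₂ hd₂ hfρ (fun y => hC _ (hsub₂ y))
    rw [hβ, hβ', intervalIntegral.integral_symm 0 H] at this
    rw [← this]
    apply intervalIntegral.integral_congr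
    intro t ht
    rw [uIcc_of_le h3.le] at ht
    simp only [r3 t ht]
  have hm0 : ∀ y, 0 ≤ ρ y - l y := fun y => by linarith [(l2 y).2, (r2 y).1]
  have hmb : ∀ y, ρ y - l y ≤ b - a := fun y => by linarith [(hsub₁ y).1, (hsub₂ y).2]
  set u : ℝ → ℝ := fun y => ω (ρ y - l y) with hu
  have huc : Continuous u := hω.continuousOn.comp_continuous (r1.sub l1) hm0
  have hub : ∀ y, |u y| ≤ ω (b - a) := by
    intro y
    rw [abs_of_nonneg (hω.nonneg (hm0 y))]
    exact hω.monotoneOn (hm0 y) ((hm0 y).trans (hmb y)) (hmb y)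
  have e3 : (∫ y in (0 : ℝ)..H, f (l y)) - ∫ y in (0 : ℝ)..H, f (ρ y) ≤
      ∫ y in (0 : ℝ)..H, u y := by
    rw [← intervalIntegral.integral_sub (hfl.intervalIntegrable _ _) (hfρ.intervalIntegrable _ _)]
    apply intervalIntegral.integral_mono_on hH.le
      ((hfl.sub hfρ).intervalIntegrable _ _) (huc.intervalIntegrable _ _)
    intro y _
    have := hf _ (hsub₁ y) _ (hsub₂ y)
    rw [abs_sub_comm (l y), abs_of_nonneg (hm0 y)] at this
    exact (le_abs_self _).trans this
  set r := rearrangement a b h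
  have hranti : AntitoneOn r (Ici 0) := rearrangement_antitoneOn hH.le hle
  have hl0 : l 0 = α := by rw [← hα]; exact l3 α ⟨le_rfl, h1.le⟩
  have hlH : l H = α' := l3 α' ⟨h1.le, le_rfl⟩
  have hρ0 : ρ 0 = β := by rw [← hβ]; exact r3 β ⟨h3.le, le_rfl⟩
  have hρH : ρ H = β' := by rw [← hβ']; exact r3 β' ⟨le_rfl, h3.le⟩
  have hex : ∀ t ∈ Icc (β' - α') (β - α), ∃ y ∈ Icc 0 H, ρ y - l y = t := by
    intro t ht
    apply intermediate_value_Icc' hH.le (f := fun y => ρ y - l y) (r1.sub l1).continuousOn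
    simpa only [hl0, hlH, hρ0, hρH] using ht
  have hmid : β' - α' ≤ β - α := by linarith
  -- A drop of the level lengthens `ρ - l` by at least the amount by which `l` moves, so `r` is no
  -- steeper than `h` and inherits its Lipschitz constant.
  have hrL : LipschitzOnWith K r (Icc (β' - α') (β - α)) := by
    apply LipschitzOnWith.of_le_add_mul
    intro s hs t ht
    rcases le_total t s with hts | hst
    · have h0' : (0 : ℝ) ≤ β' - α' := by linarith
      have := hranti (mem_Ici.2 (h0'.trans ht.1)) (mem_Ici.2 (h0'.trans hs.1)) hts
      have : 0 ≤ (K : ℝ) * dist s t := by positivity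
      linarith
    · obtain ⟨y, hy, rfl⟩ := hex s hs
      obtain ⟨z, hz, rfl⟩ := hex t ht
      rw [hr y hy, hr z hz]
      rcases le_total y z with hyz | hzy
      · have : 0 ≤ (K : ℝ) * dist (ρ y - l y) (ρ z - l z) := by positivity
        linarith
      have hl : l z ≤ l y := by
        rw [← hmono.le_iff_le (l2 z) (l2 y), l4 y hy, l4 z hz]; exact hzy
      have hρ : ρ y ≤ ρ z := by
        rw [← hanti.le_iff_ge (r2 z) (r2 y), r4 y hy, r4 z hz]; exact hzy
      have hd := hL₁.dist_le_mul _ (l2 y) _ (l2 z)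
      rw [l4 y hy, l4 z hz, Real.dist_eq, Real.dist_eq, abs_of_nonneg (sub_nonneg.2 hzy),
        abs_of_nonneg (sub_nonneg.2 hl)] at hd
      have : (K : ℝ) * (l y - l z) ≤ K * dist (ρ y - l y) (ρ z - l z) := by
        apply mul_le_mul_of_nonneg_left _ K.2
        rw [dist_comm, Real.dist_eq]
        exact le_trans (by linarith) (le_abs_self _)
      linarith
  have hrd : ∀ᵐ t, t ∈ Ioo (β' - α') (β - α) → HasDerivAt r (deriv r t) t := by
    have hac : AbsolutelyContinuousOnInterval r (β' - α') (β - α) := by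
      apply LipschitzOnWith.absolutelyContinuousOnInterval (K := K)
      rwa [uIcc_of_le hmid]
    filter_upwards [hac.ae_differentiableAt] with t ht hmem
    rw [uIcc_of_le hmid] at ht
    exact (ht (Ioo_subset_Icc_self hmem)).hasDerivAt
  -- The second change of variables, `y = r t`: there `ρ y - l y = t`, so `u (r t) = ω t`.
  have e4 : ∫ y in (0 : ℝ)..H, u y = ∫ t in (β' - α')..(β - α), -deriv r t * ω t := by
    have := integral_comp_mul_of_lipschitzOn hmid hrL hrd huc hub
    rw [show r (β - α) = 0 by rw [← hρ0, ← hl0]; exact hr 0 ⟨le_rfl, hH.le⟩,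
      show r (β' - α') = H by rw [← hρH, ← hlH]; exact hr H ⟨hH.le, le_rfl⟩] at this
    rw [intervalIntegral.integral_symm, ← this, ← intervalIntegral.integral_neg]
    apply intervalIntegral.integral_congr
    intro t ht
    rw [uIcc_of_le hmid] at ht
    obtain ⟨y, hy, rfl⟩ := hex t ht
    simp only [hr y hy, hu]
    ring
  have hba : 0 ≤ b - a := by linarith
  have e5 : ∫ t in (β' - α')..(β - α), -deriv r t * ω t ≤
      ∫ t in (0 : ℝ)..(b - a), -deriv r t * ω t := by
    apply intervalIntegral.integral_mono_interval (by linarith) hmid (by linarith)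
    · filter_upwards [ae_restrict_mem measurableSet_Ioc] with t ht
      exact mul_nonneg (neg_nonneg.2 (deriv_nonpos_of_antitoneOn_Ici hranti ht.1))
        (hω.nonneg ht.1.le)
    · have := (intervalIntegrable_deriv_mul hba hranti hω.continuousOn).neg
      simpa [Pi.neg_def] using this
  rw [e1, e2, ← sub_eq_add_neg]
  exact e3.trans (e4.trans_le e5)

/-! ### Summation over the hats of a `Σ`-representation -/

theorem eqOn_Icc_add_const {φ f : ℝ → ℝ} {x y c : ℝ} (hxy : x < y) (hφ : ContinuousOn φ (Icc x y))
    (hf : ContinuousOn f (Icc x y)) (h : ∀ t ∈ Ioo x y, φ t = f t + c) :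
    ∀ t ∈ Icc x y, φ t = f t + c := by
  have h' : EqOn φ (fun t => f t + c) (Ioo x y) := h
  exact h'.of_subset_closure hφ (hf.add continuousOn_const) Ioo_subset_Icc_self
    (by rw [closure_Ioo hxy.ne])

/-- A continuous function without zeros on an interval keeps its sign. The factor `s` lets negative
hats be handled as non-negative ones. -/
theorem IsHatFunction.exists_sign {α β : ℝ} {φ : ℝ → ℝ} (h : IsHatFunction α β φ) :
    ∃ s : ℝ, (s = 1 ∨ s = -1) ∧ ∀ t, |φ t| = s * φ t := by
  by_cases hp : ∀ t ∈ Ioo α β, 0 < φ t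
  · refine ⟨1, Or.inl rfl, fun t => ?_⟩
    by_cases ht : t ∈ Ioo α β
    · rw [abs_of_pos (hp t ht), one_mul]
    · simp [h.eq_zero t ht]
  · push Not at hp
    obtain ⟨x, hx, hx0⟩ := hp
    have hneg : ∀ t ∈ Ioo α β, φ t < 0 := by
      intro t ht
      by_contra! hn
      obtain ⟨z, hz, hz0⟩ := isPreconnected_Ioo.intermediate_value hx ht
        (h.continuousOn.mono Ioo_subset_Icc_self) ⟨hx0, hn⟩
      have := h.abs_pos z hz
      rw [hz0] at this
      simp at this
    refine ⟨-1, Or.inr rfl, fun t => ?_⟩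
    by_cases ht : t ∈ Ioo α β
    · rw [abs_of_neg (hneg t ht)]; ring
    · simp [h.eq_zero t ht]

/-- A hat function is recovered from its values on the two segments of monotonicity. -/
theorem IsHatWithIntervals.eq_clamp {α α' β' β : ℝ} {φ : ℝ → ℝ}
    (h : IsHatWithIntervals α α' β' β φ) (t : ℝ) :
    φ t = (φ (max α (min α' t)) - φ α) + (φ (max β' (min β t)) - φ β') := by
  have hα : φ α = 0 := h.isHat.eq_zero _ (by simp)
  have hβ : φ β = 0 := h.isHat.eq_zero _ (by simp)
  have h1 := h.lt_left
  have h2 := h.le_mid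
  have h3 := h.lt_right
  have hβ' : φ β' = φ α' := h.const _ ⟨h2, le_rfl⟩
  rcases le_total t α with ht | ht
  · rw [min_eq_right (by linarith), max_eq_left ht, min_eq_right (by linarith),
      max_eq_left (by linarith), h.isHat.eq_zero t (fun hh => absurd hh.1 ht.not_gt)]
    ring
  rcases le_total t α' with ht1 | ht1
  · rw [min_eq_right (by linarith), max_eq_right ht, min_eq_right (by linarith),
      max_eq_left (by linarith), hα]
    ring
  rcases le_total t β' with ht2 | ht2
  · rw [min_eq_left ht1, max_eq_right h1.le, min_eq_right (by linarith),
      max_eq_left ht2, hα, h.const t ⟨ht1, ht2⟩]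
    ring
  rcases le_total t β with ht3 | ht3
  · rw [min_eq_left ht1, max_eq_right h1.le, min_eq_right ht3,
      max_eq_right ht2, hα, hβ']
    ring
  · rw [min_eq_left ht1, max_eq_right h1.le, min_eq_left ht3,
      max_eq_right h3.le, hα, hβ', hβ, h.isHat.eq_zero t (fun hh => absurd hh.2 ht3.not_gt)]
    ring

/-- Together with `IsHatWithIntervals.eq_clamp` this expresses a hat as an integral of `ψ` over its
two monotonicity intervals, cut off at `t`. -/
theorem setIntegral_Ioo_inter_Iic {ψ Ψ : ℝ → ℝ} {a b c d : ℝ} (hac : a ≤ c) (hcd : c ≤ d)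
    (hdb : d ≤ b) (hψ : IntervalIntegrable ψ volume a b)
    (hΨ : ∀ t ∈ Icc a b, Ψ t = ∫ u in a..t, ψ u) (t : ℝ) :
    ∫ u in Ioo c d ∩ Iic t, ψ u = Ψ (max c (min d t)) - Ψ c := by
  have hab : a ≤ b := hac.trans (hcd.trans hdb)
  have hx : max c (min d t) ≤ d := max_le hcd (min_le_left _ _)
  have hsub : ∀ x ∈ Icc a b, IntervalIntegrable ψ volume a x := fun x hx =>
    hψ.mono_set (by rw [uIcc_of_le hab, uIcc_of_le hx.1]; exact Icc_subset_Icc le_rfl hx.2)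
  have hc : c ∈ Icc a b := ⟨hac, hcd.trans hdb⟩
  have hm : max c (min d t) ∈ Icc a b := ⟨hac.trans (le_max_left _ _), hx.trans hdb⟩
  rw [hΨ _ hm, hΨ _ hc, intervalIntegral.integral_interval_sub_left (hsub _ hm) (hsub _ hc),
    intervalIntegral.integral_of_le (le_max_left _ _)]
  rcases le_total t c with h1 | h1
  · have e1 : Ioo c d ∩ Iic t = ∅ := by
      ext u; simp only [mem_inter_iff, mem_Ioo, mem_Iic, mem_empty_iff_false, iff_false]
      rintro ⟨⟨h, -⟩, h'⟩; linarith
    rw [e1, min_eq_right (h1.trans hcd), max_eq_left h1, Ioc_self]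
  · rcases lt_or_ge t d with h2 | h2
    · have e1 : Ioo c d ∩ Iic t = Ioc c t := by
        ext u; simp only [mem_inter_iff, mem_Ioo, mem_Iic, mem_Ioc]
        exact ⟨fun h => ⟨h.1.1, h.2⟩, fun h => ⟨⟨h.1, h.2.trans_lt h2⟩, h.2⟩⟩
      rw [e1, min_eq_right h2.le, max_eq_right h1]
    · have e1 : Ioo c d ∩ Iic t = Ioo c d := by
        ext u; simp only [mem_inter_iff, mem_Ioo, mem_Iic]
        exact ⟨fun h => h.1, fun h => ⟨h, h.2.le.trans h2⟩⟩
      rw [e1, min_eq_left h2, max_eq_right hcd, integral_Ioc_eq_integral_Ioo]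

/-- The derivative of a function with a `Σ`-representation is concentrated on the intervals of
strict monotonicity of the hats. -/
theorem ae_mem_iUnion_of_hasSum {ι : Type} [Countable ι] {a b : ℝ} {ψ Ψ : ℝ → ℝ} (hab : a < b)
    (hψ : IntervalIntegrable ψ volume a b) (hΨ : ∀ t ∈ Icc a b, Ψ t = ∫ u in a..t, ψ u)
    {S : ι → Set ℝ} (hS : ∀ k, MeasurableSet (S k)) (hSab : ∀ k, S k ⊆ Ioc a b)
    (hdisj : Pairwise (Function.onFun Disjoint S))
    (hsum : ∀ t ∈ Icc a b, HasSum (fun k => ∫ u in S k ∩ Iic t, ψ u) (Ψ t)) :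
    ∀ᵐ t, t ∈ Ioc a b → t ∉ ⋃ k, S k → ψ t = 0 := by
  set G := ⋃ k, S k with hG
  have hGm : MeasurableSet G := MeasurableSet.iUnion hS
  have hGab : G ⊆ Ioc a b := iUnion_subset hSab
  have hint : IntegrableOn ψ (Ioc a b) := (intervalIntegrable_iff_integrableOn_Ioc_of_le hab.le).1 hψ
  have hindI : IntervalIntegrable (G.indicator ψ) volume a b :=
    (intervalIntegrable_iff_integrableOn_Ioc_of_le hab.le).2 (hint.indicator hGm)
  -- The primitive of `ψ` and that of its restriction to `G` agree everywhere on the segment, so by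
  -- Lebesgue differentiation the integrands agree almost everywhere.
  have h1 : ∀ t ∈ Icc a b, ∫ u in a..t, (ψ u - G.indicator ψ u) = 0 := by
    intro t ht
    have hs := hasSum_integral_iUnion (μ := volume) (f := ψ) (s := fun k => S k ∩ Iic t)
      (fun k => (hS k).inter measurableSet_Iic)
      (fun i j hij => (hdisj hij).mono inter_subset_left inter_subset_left)
      (hint.mono_set (iUnion_subset fun k => inter_subset_left.trans (hSab k)))
    have hu := hs.unique (hsum t ht)
    rw [← iUnion_inter, ← hG] at hu
    have hsubI : uIcc a t ⊆ uIcc a b := by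
      rw [uIcc_of_le hab.le, uIcc_of_le ht.1]; exact Icc_subset_Icc le_rfl ht.2
    rw [intervalIntegral.integral_sub (hψ.mono_set hsubI) (hindI.mono_set hsubI), ← hΨ t ht,
      ← hu, intervalIntegral.integral_of_le ht.1, setIntegral_indicator hGm, sub_eq_zero]
    congr 2
    ext u
    simp only [mem_inter_iff, mem_Iic, mem_Ioc]
    exact ⟨fun h => ⟨⟨(hGab h.1).1, h.2⟩, h.1⟩, fun h => ⟨h.2, h.1.2⟩⟩
  have hne : ∀ᵐ t : ℝ, t ≠ b := by simp [ae_iff, measure_singleton]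
  filter_upwards [(hψ.sub hindI).ae_hasDerivAt_integral, hne] with t ht htb hmem htG
  rw [uIcc_of_le hab.le] at ht
  have hd := ht (Ioc_subset_Icc_self hmem) a ⟨le_rfl, hab.le⟩
  have hev : (fun x => ∫ u in a..x, (ψ - G.indicator ψ) u) =ᶠ[𝓝 t] fun _ => 0 := by
    filter_upwards [Ioo_mem_nhds hmem.1 (lt_of_le_of_ne hmem.2 htb)] with x hx
    exact h1 x (Ioo_subset_Icc_self hx)
  have h0 := (hd.congr_of_eventuallyEq hev.symm).unique (hasDerivAt_const t (0 : ℝ))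
  simpa [Pi.sub_apply, indicator_of_notMem htG] using h0

/-- The terms outside `s` sum to an antitone function, whose derivative is non-positive. Splitting
it off means that only a finite sum is differentiated termwise. -/
theorem HasSum.neg_deriv_le {ι : Type} {r : ι → ℝ → ℝ} {T : ℝ}
    (hr : ∀ k, AntitoneOn (r k) (Ici 0)) (hsum : ∀ t, 0 ≤ t → Summable fun k => r k t)
    (s : Finset ι) :
    ∀ᵐ t, t ∈ Ioc 0 T → ∑ k ∈ s, -deriv (r k) t ≤ |deriv (fun t => ∑' k, r k t) t| := by
  set R : ℝ → ℝ := fun t => ∑' k, r k t with hR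
  set Q : ℝ → ℝ := fun t => ∑' k : {k // k ∉ s}, r k t with hQ
  have hRanti : AntitoneOn R (Ici 0) := fun x hx y hy hxy =>
    (hsum y hy).tsum_le_tsum (fun k => hr k hx hy hxy) (hsum x hx)
  have hQanti : AntitoneOn Q (Ici 0) := fun x hx y hy hxy =>
    ((hsum y hy).subtype _).tsum_le_tsum (fun k => hr k hx hy hxy) ((hsum x hx).subtype _)
  have hdiff : ∀ g : ℝ → ℝ, AntitoneOn g (Ici 0) → ∀ᵐ t, 0 < t → DifferentiableAt ℝ g t := by
    intro g hg
    have hg' : MonotoneOn (fun t => -g t) (Ici 0) := hg.neg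
    filter_upwards [hg'.ae_differentiableWithinAt_of_mem] with t ht h0
    have := ((ht (mem_Ici.2 h0.le)).differentiableAt (Ici_mem_nhds h0)).neg
    simpa [Pi.neg_def] using this
  have hall : ∀ᵐ t, ∀ k ∈ s, 0 < t → DifferentiableAt ℝ (r k) t :=
    (ae_ball_iff s.countable_toSet).2 fun k _ => hdiff _ (hr k)
  filter_upwards [hall, hdiff Q hQanti] with t h1 h2 ht
  have hs : HasDerivAt (fun t => ∑ k ∈ s, r k t) (∑ k ∈ s, deriv (r k) t) t :=
    HasDerivAt.fun_sum fun k hk => (h1 k hk ht.1).hasDerivAt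
  have hRt : HasDerivAt R (∑ k ∈ s, deriv (r k) t + deriv Q t) t := by
    apply (hs.add (h2 ht.1).hasDerivAt).congr_of_eventuallyEq
    filter_upwards [lt_mem_nhds ht.1] with x hx
    exact ((hsum x hx.le).sum_add_tsum_subtype_compl s).symm
  rw [hRt.deriv, abs_of_nonpos, Finset.sum_neg_distrib]
  · linarith [deriv_nonpos_of_antitoneOn_Ici hQanti ht.1]
  · rw [← hRt.deriv]; exact deriv_nonpos_of_antitoneOn_Ici hRanti ht.1

theorem IsHatWithIntervals.abs_le {α α' β' β : ℝ} {φ : ℝ → ℝ}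
    (h : IsHatWithIntervals α α' β' β φ) (t : ℝ) : |φ t| ≤ |φ α'| :=
  le_apply_of_hat (h := fun t => |φ t|) h.lt_left h.le_mid h.lt_right
    (fun t ht => by simp [h.isHat.eq_zero t ht]) h.strictMonoOn
    (fun t ht => by simp only [h.const t ht]) h.strictAntiOn t

theorem lipschitzOnWith_of_integral {ψ Ψ : ℝ → ℝ} {a b M : ℝ} (hM0 : 0 ≤ M)
    (hψ : IntervalIntegrable ψ volume a b) (hM : ∀ t ∈ Icc a b, |ψ t| ≤ M)
    (hΨ : ∀ t ∈ Icc a b, Ψ t = ∫ u in a..t, ψ u) : LipschitzOnWith M.toNNReal Ψ (Icc a b) := by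
  apply LipschitzOnWith.of_dist_le_mul
  intro x hx y hy
  have hab : a ≤ b := hx.1.trans hx.2
  have hsub : ∀ x ∈ Icc a b, IntervalIntegrable ψ volume a x := fun x hx =>
    hψ.mono_set (by rw [uIcc_of_le hab, uIcc_of_le hx.1]; exact Icc_subset_Icc le_rfl hx.2)
  rw [Real.coe_toNNReal _ hM0, dist_comm, Real.dist_eq, dist_comm, Real.dist_eq, hΨ x hx, hΨ y hy,
    intervalIntegral.integral_interval_sub_left (hsub _ hy) (hsub _ hx)]
  refine intervalIntegral.norm_integral_le_of_norm_le_const (f := ψ) fun z hz => hM z ?_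
  have := uIoc_subset_uIcc hz
  exact uIcc_subset_Icc hx hy this

/-- The estimate for a single hat function of a `Σ`-representation. -/
theorem IsHatWithIntervals.integral_mul_le {a b α α' β' β M : ℝ} {φ ψ Ψ f ω : ℝ → ℝ}
    (h : IsHatWithIntervals α α' β' β φ) (haα : a ≤ α) (hβb : β ≤ b)
    (hM0 : 0 ≤ M) (hψ : IntervalIntegrable ψ volume a b) (hM : ∀ t ∈ Icc a b, |ψ t| ≤ M)
    (hΨ : ∀ t ∈ Icc a b, Ψ t = ∫ u in a..t, ψ u)
    (hc : ∃ c, ∀ t ∈ Ioo α α' ∪ Ioo β' β, φ t = Ψ t + c)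
    (hω : IsModulusOfContinuity ω)
    (hf : ∀ s ∈ Icc a b, ∀ t ∈ Icc a b, |f s - f t| ≤ ω |s - t|) :
    (∫ t in α..α', f t * ψ t) + (∫ t in β'..β, f t * ψ t) ≤
      ∫ t in (0 : ℝ)..(b - a), -deriv (rearrangement a b fun s => |φ s|) t * ω t := by
  obtain ⟨s, hs, hsφ⟩ := h.isHat.exists_sign
  obtain ⟨c, hc⟩ := hc
  have h1 := h.lt_left
  have h2 := h.le_mid
  have h3 := h.lt_right
  have hss : s * s = 1 := by rcases hs with rfl | rfl <;> norm_num
  have habs : |s| = 1 := by rcases hs with rfl | rfl <;> norm_num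
  have hΨL := lipschitzOnWith_of_integral hM0 hψ hM hΨ
  have hI₁ : Icc α α' ⊆ Icc a b := Icc_subset_Icc haα (by linarith)
  have hI₂ : Icc β' β ⊆ Icc a b := Icc_subset_Icc (by linarith) hβb
  have hab : a ≤ b := by linarith
  have hc₁ := eqOn_Icc_add_const h1 (h.isHat.continuousOn.mono (Icc_subset_Icc le_rfl (by linarith)))
    (hΨL.continuousOn.mono hI₁) fun t ht => hc t (Or.inl ht)
  have hc₂ := eqOn_Icc_add_const h3 (h.isHat.continuousOn.mono (Icc_subset_Icc (by linarith) le_rfl))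
    (hΨL.continuousOn.mono hI₂) fun t ht => hc t (Or.inr ht)
  have hL : ∀ x y, Icc x y ⊆ Icc a b → (∀ t ∈ Icc x y, φ t = Ψ t + c) →
      LipschitzOnWith M.toNNReal (fun t => |φ t|) (Icc x y) := by
    intro x y hxy hφ
    apply LipschitzOnWith.of_dist_le_mul
    intro u hu v hv
    refine le_trans ?_ (hΨL.dist_le_mul u (hxy hu) v (hxy hv))
    rw [Real.dist_eq, Real.dist_eq]
    refine (abs_abs_sub_abs_le_abs_sub _ _).trans ?_
    rw [hφ u hu, hφ v hv, add_sub_add_right_eq_sub]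
  have hd : ∀ x y, Icc x y ⊆ Icc a b → (∀ t ∈ Icc x y, φ t = Ψ t + c) →
      ∀ᵐ t, t ∈ Ioo x y → HasDerivAt (fun t => |φ t|) (s * ψ t) t := by
    intro x y hxy hφ
    filter_upwards [hψ.ae_hasDerivAt_integral] with t ht hmem
    rw [uIcc_of_le hab] at ht
    have := (ht (hxy (Ioo_subset_Icc_self hmem)) a ⟨le_rfl, hab⟩).add_const c
    apply (this.const_mul s).congr_of_eventuallyEq
    filter_upwards [Ioo_mem_nhds hmem.1 hmem.2] with z hz
    rw [hsφ, hφ z (Ioo_subset_Icc_self hz), hΨ z (hxy (Ioo_subset_Icc_self hz))]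
  -- Multiplying both `f` and `ψ` by the sign `s` makes `s * ψ` the derivative of `|φ|` and leaves
  -- the product `f * ψ` unchanged.
  have key := integral_mul_le_of_hat (h := fun t => |φ t|) (ψ := fun t => s * ψ t)
    (f := fun t => s * f t) haα hβb h1 h2 h3
    (fun t ht => by simp [h.isHat.eq_zero t ht]) h.isHat.continuousOn.abs h.strictMonoOn
    (fun t ht => by simp only [h.const t ht]) h.strictAntiOn (hL _ _ hI₁ hc₁) (hL _ _ hI₂ hc₂)
    (hd _ _ hI₁ hc₁) (hd _ _ hI₂ hc₂) hω
    (fun x hx y hy => by rw [← mul_sub, abs_mul, habs, one_mul]; exact hf x hx y hy)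
  refine le_trans (le_of_eq ?_) key
  have : ∀ t, s * f t * (s * ψ t) = f t * ψ t := fun t => by
    rw [show s * f t * (s * ψ t) = (s * s) * (f t * ψ t) by ring, hss, one_mul]
  simp only [this]

/-- The main estimate for real functions. -/
theorem IsSigmaRepresentation.integral_mul_le {ι : Type} [Countable ι] {a b M : ℝ}
    {φ : ι → ℝ → ℝ} {ψ Ψ f ω : ℝ → ℝ} (h : IsSigmaRepresentation a b Ψ φ) (hab : a < b)
    (hψ : IntervalIntegrable ψ volume a b) (hM : ∀ t ∈ Icc a b, |ψ t| ≤ M)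
    (hΨ : ∀ t ∈ Icc a b, Ψ t = ∫ u in a..t, ψ u) (hω : IsModulusOfContinuity ω)
    (hf : ∀ s ∈ Icc a b, ∀ t ∈ Icc a b, |f s - f t| ≤ ω |s - t|) :
    ∫ t in a..b, f t * ψ t ≤
      ∫ t in (0 : ℝ)..(b - a), |deriv (sigmaRearrangement a b φ) t| * ω t := by
  obtain ⟨α, α', β', β, hk, hsum, -, hdisj, hc⟩ := h
  have hM0 : 0 ≤ M := (abs_nonneg _).trans (hM a ⟨le_rfl, hab.le⟩)
  have hΨL := lipschitzOnWith_of_integral hM0 hψ hM hΨ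
  set S : ι × Bool → Set ℝ := fun p =>
    if p.2 then Ioo (α p.1) (α' p.1) else Ioo (β' p.1) (β p.1) with hS
  have hSt : ∀ k, S (k, true) = Ioo (α k) (α' k) := fun k => rfl
  have hSf : ∀ k, S (k, false) = Ioo (β' k) (β k) := fun k => rfl
  have hI₁ : ∀ k, Icc (α k) (α' k) ⊆ Icc a b := fun k =>
    Icc_subset_Icc (hk k).1 (by linarith [(hk k).2.1, (hk k).2.2.le_mid, (hk k).2.2.lt_right])
  have hI₂ : ∀ k, Icc (β' k) (β k) ⊆ Icc a b := fun k =>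
    Icc_subset_Icc (by linarith [(hk k).1, (hk k).2.2.le_mid, (hk k).2.2.lt_left]) (hk k).2.1
  have hSm : ∀ p, MeasurableSet (S p) := by
    rintro ⟨k, _ | _⟩
    · exact measurableSet_Ioo
    · exact measurableSet_Ioo
  have hSab : ∀ p, S p ⊆ Ioc a b := by
    rintro ⟨k, _ | _⟩ t ht
    · have := hI₂ k ⟨le_rfl, (hk k).2.2.lt_right.le⟩
      exact ⟨this.1.trans_lt ht.1, ht.2.le.trans (hk k).2.1⟩
    · have := hI₁ k ⟨(hk k).2.2.lt_left.le, le_rfl⟩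
      exact ⟨(hk k).1.trans_lt ht.1, ht.2.le.trans this.2⟩
  have hSd : Pairwise (Function.onFun Disjoint S) := hdisj
  have hint : IntegrableOn ψ (Ioc a b) :=
    (intervalIntegrable_iff_integrableOn_Ioc_of_le hab.le).1 hψ
  have hfiber : ∀ (F : ι × Bool → ℝ) (I : ℝ), HasSum F I →
      HasSum (fun k => F (k, true) + F (k, false)) I := by
    intro F I hF
    apply hF.prod_fiberwise
    intro k
    have := hasSum_fintype (fun b : Bool => F (k, b))
    simpa using this
  have hφS : ∀ k t, φ k t =
      (∫ u in S (k, true) ∩ Iic t, ψ u) + ∫ u in S (k, false) ∩ Iic t, ψ u := by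
    intro k t
    obtain ⟨c, hc⟩ := hc k
    have hh := (hk k).2.2
    have h1 := hh.lt_left
    have h2 := hh.le_mid
    have h3 := hh.lt_right
    have hc₁ := eqOn_Icc_add_const h1
      (hh.isHat.continuousOn.mono (Icc_subset_Icc le_rfl (by linarith)))
      (hΨL.continuousOn.mono (hI₁ k)) fun t ht => hc t (Or.inl ht)
    have hc₂ := eqOn_Icc_add_const h3
      (hh.isHat.continuousOn.mono (Icc_subset_Icc (by linarith) le_rfl))
      (hΨL.continuousOn.mono (hI₂ k)) fun t ht => hc t (Or.inr ht)
    rw [hSt, hSf, setIntegral_Ioo_inter_Iic (hk k).1 h1.le (hI₁ k ⟨h1.le, le_rfl⟩).2 hψ hΨ,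
      setIntegral_Ioo_inter_Iic (hI₂ k ⟨le_rfl, h3.le⟩).1 h3.le (hk k).2.1 hψ hΨ, hh.eq_clamp t,
      hc₁ _ ⟨le_max_left _ _, max_le h1.le (min_le_left _ _)⟩, hc₁ _ ⟨le_rfl, h1.le⟩,
      hc₂ _ ⟨le_max_left _ _, max_le h3.le (min_le_left _ _)⟩, hc₂ _ ⟨le_rfl, h3.le⟩]
    ring
  -- Integrability of `ψ` over the disjoint pieces gives convergence over all pairs; grouping the
  -- two pieces of each hat identifies the sum as `Ψ t`.
  have hsumS : ∀ t ∈ Icc a b, HasSum (fun p => ∫ u in S p ∩ Iic t, ψ u) (Ψ t) := by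
    intro t ht
    have hs := hasSum_integral_iUnion (μ := volume) (f := ψ) (s := fun p => S p ∩ Iic t)
      (fun p => (hSm p).inter measurableSet_Iic)
      (fun i j hij => (hSd hij).mono inter_subset_left inter_subset_left)
      (hint.mono_set (iUnion_subset fun k => inter_subset_left.trans (hSab k)))
    have h2 := hfiber _ _ hs
    simp only [← hφS] at h2
    rwa [← h2.unique (hsum t ht)]
  have hae := ae_mem_iUnion_of_hasSum hab hψ hΨ hSm hSab hSd hsumS
  have hfc : ContinuousOn f (Icc a b) := hω.continuousOn_of_dist_le hf
  have hfψ : IntegrableOn (fun t => f t * ψ t) (Ioc a b) := by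
    rw [← intervalIntegrable_iff_integrableOn_Ioc_of_le hab.le]
    exact hψ.continuousOn_mul (by rwa [uIcc_of_le hab.le])
  have hfψS : HasSum (fun p => ∫ t in S p, f t * ψ t) (∫ t in a..b, f t * ψ t) := by
    have := hasSum_integral_iUnion hSm hSd (hfψ.mono_set (iUnion_subset hSab))
    suffices hE : ∫ t in a..b, f t * ψ t = ∫ t in ⋃ p, S p, f t * ψ t by rwa [hE]
    rw [intervalIntegral.integral_of_le hab.le]
    apply setIntegral_eq_of_subset_of_ae_sdiff_eq_zero measurableSet_Ioc.nullMeasurableSet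
      (iUnion_subset hSab)
    filter_upwards [hae] with t ht hmem
    rw [ht hmem.1 hmem.2, mul_zero]
  have hba : 0 ≤ b - a := by linarith
  set r : ι → ℝ → ℝ := fun k => rearrangement a b (fun s => |φ k s|) with hr
  have hranti : ∀ k, AntitoneOn (r k) (Ici 0) := fun k =>
    rearrangement_antitoneOn (abs_nonneg _) (hk k).2.2.abs_le
  -- Each rearrangement is bounded by the height of its hat, and this height is the absolute value
  -- of the integral of `ψ` over the left interval. These integrals are absolutely summable.
  have hrsum : ∀ t, 0 ≤ t → Summable fun k => r k t := by
    intro t ht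
    have h1 := ((hsumS b ⟨hab.le, le_rfl⟩).summable.abs).comp_injective
      (i := fun k : ι => (k, true)) (fun i j hij => (Prod.ext_iff.1 hij).1)
    refine Summable.of_nonneg_of_le (fun k => rearrangement_nonneg _ _ _ _) (fun k => ?_) h1
    refine (rearrangement_le (abs_nonneg _) (hk k).2.2.abs_le ht).trans (le_of_eq ?_)
    have hh := (hk k).2.2
    have e1 : S (k, true) ∩ Iic b = S (k, true) ∩ Iic (α' k) := by
      rw [hSt, inter_eq_left.2 (show Ioo (α k) (α' k) ⊆ Iic b from
          fun t ht => (hI₁ k (Ioo_subset_Icc_self ht)).2),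
        inter_eq_left.2 (show Ioo (α k) (α' k) ⊆ Iic (α' k) from fun t ht => ht.2.le)]
    have e2 : S (k, false) ∩ Iic (α' k) = ∅ := by
      ext t
      rw [hSf]
      simp only [mem_inter_iff, mem_Ioo, mem_Iic, mem_empty_iff_false, iff_false]
      rintro ⟨⟨h, -⟩, h'⟩
      linarith [hh.le_mid]
    simp only [Function.comp]
    rw [e1, hφS k (α' k), e2, setIntegral_empty, add_zero]
  -- It suffices to bound finite partial sums, so no infinite sum is interchanged with the integral
  -- of the `-r'`.
  refine hasSum_le_of_sum_le (hfiber _ _ hfψS) fun s => ?_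
  have hle : ∀ k ∈ s, (∫ t in S (k, true), f t * ψ t) + (∫ t in S (k, false), f t * ψ t) ≤
      ∫ t in (0 : ℝ)..(b - a), -deriv (r k) t * ω t := by
    intro k _
    have hh := (hk k).2.2
    have := hh.integral_mul_le (hk k).1 (hk k).2.1 hM0 hψ hM hΨ (hc k) hω hf
    rwa [intervalIntegral.integral_of_le hh.lt_left.le,
      intervalIntegral.integral_of_le hh.lt_right.le, integral_Ioc_eq_integral_Ioo,
      integral_Ioc_eq_integral_Ioo] at this
  refine (Finset.sum_le_sum hle).trans ?_
  have hri : ∀ k, IntervalIntegrable (fun t => -deriv (r k) t * ω t) volume 0 (b - a) := by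
    intro k
    have := (intervalIntegrable_deriv_mul hba (hranti k) hω.continuousOn).neg
    simpa [Pi.neg_def] using this
  rw [← intervalIntegral.integral_finsetSum fun k _ => hri k]
  have hRanti : AntitoneOn (sigmaRearrangement a b φ) (Ici 0) := fun x hx y hy hxy =>
    (hrsum y hy).tsum_le_tsum (fun k => hranti k hx hy hxy) (hrsum x hx)
  have hne : ∀ᵐ t : ℝ, t ≠ 0 := by simp [ae_iff, measure_singleton]
  apply intervalIntegral.integral_mono_ae_restrict hba
  · simpa [Finset.sum_fn] using IntervalIntegrable.sum s fun k _ => hri k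
  · have := (intervalIntegrable_deriv_mul hba hRanti hω.continuousOn).abs
    apply this.congr
    intro t ht
    rw [uIoc_of_le hba] at ht
    simp only [abs_mul, abs_of_nonneg (hω.nonneg ht.1.le)]
  · filter_upwards [ae_restrict_mem measurableSet_Icc, ae_restrict_of_ae hne,
      ae_restrict_of_ae (HasSum.neg_deriv_le (T := b - a) hranti hrsum s)] with t ht h0 hle
    rw [← Finset.sum_mul]
    exact mul_le_mul_of_nonneg_right (hle ⟨lt_of_le_of_ne ht.1 h0.symm, ht.2⟩) (hω.nonneg ht.1)

/-! ### Cutting a function into hats between critical levels -/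

/-- The interval `(p.1, p.2)` is a connected component of the open set `U`. -/
def IsOpenComponent (U : Set ℝ) (p : ℝ × ℝ) : Prop :=
  p.1 < p.2 ∧ Ioo p.1 p.2 ⊆ U ∧ p.1 ∉ U ∧ p.2 ∉ U

theorem IsOpenComponent.eq {U : Set ℝ} {p q : ℝ × ℝ} (hp : IsOpenComponent U p)
    (hq : IsOpenComponent U q) {t : ℝ} (htp : t ∈ Ioo p.1 p.2) (htq : t ∈ Ioo q.1 q.2) : p = q := by
  apply Prod.ext
  · apply le_antisymm
    · by_contra! h
      exact hp.2.2.1 (hq.2.1 ⟨h, htp.1.trans htq.2⟩)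
    · by_contra! h
      exact hq.2.2.1 (hp.2.1 ⟨h, htq.1.trans htp.2⟩)
  · apply le_antisymm
    · by_contra! h
      exact hq.2.2.2 (hp.2.1 ⟨htp.1.trans htq.2, h⟩)
    · by_contra! h
      exact hp.2.2.2 (hq.2.1 ⟨htq.1.trans htp.2, h⟩)

/-- The endpoints are the points of the complement nearest to `t` on either side. They exist by
compactness because `A` and `B` lie outside `U`. -/
theorem exists_isOpenComponent {U : Set ℝ} (hU : IsOpen U) {A B t : ℝ} (hUAB : U ⊆ Ioo A B)
    (ht : t ∈ U) : ∃ p, IsOpenComponent U p ∧ t ∈ Ioo p.1 p.2 := by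
  have htAB := hUAB ht
  obtain ⟨x, hx, hxm⟩ := (isCompact_Icc.inter_right hU.isClosed_compl :
    IsCompact (Icc A t ∩ Uᶜ)).exists_isGreatest
      ⟨A, ⟨le_rfl, htAB.1.le⟩, fun h => lt_irrefl _ (hUAB h).1⟩
  obtain ⟨y, hy, hym⟩ := (isCompact_Icc.inter_right hU.isClosed_compl :
    IsCompact (Icc t B ∩ Uᶜ)).exists_isLeast
      ⟨B, ⟨htAB.2.le, le_rfl⟩, fun h => lt_irrefl _ (hUAB h).2⟩
  have hxt : x < t := lt_of_le_of_ne hx.1.2 fun h => hx.2 (h ▸ ht)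
  have hty : t < y := lt_of_le_of_ne hy.1.1 fun h => hy.2 (h ▸ ht)
  refine ⟨(x, y), ⟨hxt.trans hty, fun z hz => ?_, hx.2, hy.2⟩, hxt, hty⟩
  by_contra hzU
  rcases le_total z t with h | h
  · exact hz.1.not_ge (hxm ⟨⟨hx.1.1.trans hz.1.le, h⟩, hzU⟩)
  · exact hz.2.not_ge (hym ⟨⟨h, hz.2.le.trans hy.1.2⟩, hzU⟩)

/-- The part of `F` over the interval `(α, β)` between the levels `p` and `q`. -/
noncomputable def levelHat (F : ℝ → ℝ) (p q α β : ℝ) : ℝ → ℝ :=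
  (Ioo α β).indicator fun t => min (F t) q - p

/-- With no local extreme value strictly between `p` and `q`, the maximum over the segment must
reach `q`. Between the first and the last point where it does, `F` cannot dip below `q`, since an
interior minimum would be a forbidden value. Outside these points Rolle's theorem makes `F`
injective, hence strictly monotone. -/
theorem exists_isHatWithIntervals_levelHat {F : ℝ → ℝ} (hF : Continuous F) {p q α β : ℝ}
    (hpq : p < q) (hαβ : α < β) (hpos : ∀ t ∈ Ioo α β, p < F t) (hα : F α ≤ p) (hβ : F β ≤ p)
    (hreg : ∀ t, IsLocalExtr F t → F t ∉ Ioo p q) :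
    ∃ α' β', IsHatWithIntervals α α' β' β (levelHat F p q α β) ∧
      ∀ t ∈ Ioo α α' ∪ Ioo β' β, F t ∈ Ioo p q := by
  have hge : ∀ t ∈ Icc α β, p ≤ F t := by
    have : Icc α β ⊆ {t | p ≤ F t} := by
      rw [← closure_Ioo hαβ.ne]
      exact closure_minimal (fun t ht => (hpos t ht).le) (isClosed_le continuous_const hF)
    exact this
  have hα : F α = p := le_antisymm hα (hge _ ⟨le_rfl, hαβ.le⟩)
  have hβ : F β = p := le_antisymm hβ (hge _ ⟨hαβ.le, le_rfl⟩)
  have hne : (Icc α β ∩ {t | q ≤ F t}).Nonempty := by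
    obtain ⟨m, hm, hmax⟩ := isCompact_Icc.exists_isMaxOn (nonempty_Icc.2 hαβ.le)
      (hF.continuousOn (s := Icc α β))
    have hmp : p < F m :=
      (hpos ((α + β) / 2) ⟨by linarith, by linarith⟩).trans_le
        (hmax (show (α + β) / 2 ∈ Icc α β from ⟨by linarith, by linarith⟩))
    have hmI : m ∈ Ioo α β :=
      ⟨lt_of_le_of_ne hm.1 fun h => by rw [← h, hα] at hmp; exact lt_irrefl _ hmp,
        lt_of_le_of_ne hm.2 fun h => by rw [h, hβ] at hmp; exact lt_irrefl _ hmp⟩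
    refine ⟨m, hm, ?_⟩
    by_contra hmq
    exact hreg m (Or.inr (hmax.isLocalMax (Icc_mem_nhds hmI.1 hmI.2))) ⟨hmp, not_le.1 hmq⟩
  have hcomp : IsCompact (Icc α β ∩ {t | q ≤ F t}) :=
    isCompact_Icc.inter_right (isClosed_le continuous_const hF)
  obtain ⟨α', hα', hα'm⟩ := hcomp.exists_isLeast hne
  obtain ⟨β', hβ', hβ'm⟩ := hcomp.exists_isGreatest hne
  have hα'q : q ≤ F α' := hα'.2
  have hβ'q : q ≤ F β' := hβ'.2
  have h1 : α < α' := lt_of_le_of_ne hα'.1.1 fun h => by rw [← h, hα] at hα'q; linarith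
  have h3 : β' < β := lt_of_le_of_ne hβ'.1.2 fun h => by rw [h, hβ] at hβ'q; linarith
  have h2 : α' ≤ β' := hα'm hβ'
  have hlt₁ : ∀ t ∈ Ico α α', F t < q := by
    intro t ht
    by_contra! h
    exact ht.2.not_ge (hα'm ⟨⟨ht.1, ht.2.le.trans hα'.1.2⟩, h⟩)
  have hlt₂ : ∀ t ∈ Ioc β' β, F t < q := by
    intro t ht
    by_contra! h
    exact ht.1.not_ge (hβ'm ⟨⟨hβ'.1.1.trans ht.1.le, ht.2⟩, h⟩)
  have hle₁ : ∀ t ∈ Icc α α', F t ≤ q := by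
    have : Icc α α' ⊆ {t | F t ≤ q} := by
      rw [← closure_Ico h1.ne]
      exact closure_minimal (fun t ht => (hlt₁ t ht).le) (isClosed_le hF continuous_const)
    exact this
  have hle₂ : ∀ t ∈ Icc β' β, F t ≤ q := by
    have : Icc β' β ⊆ {t | F t ≤ q} := by
      rw [← closure_Ioc h3.ne]
      exact closure_minimal (fun t ht => (hlt₂ t ht).le) (isClosed_le hF continuous_const)
    exact this
  have hα'e : F α' = q := le_antisymm (hle₁ _ ⟨h1.le, le_rfl⟩) hα'q
  have hβ'e : F β' = q := le_antisymm (hle₂ _ ⟨le_rfl, h3.le⟩) hβ'q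
  have hmid : ∀ t ∈ Icc α' β', q ≤ F t := by
    intro t ht
    by_contra! h
    obtain ⟨m, hm, hmin⟩ := isCompact_Icc.exists_isMinOn ⟨t, ht⟩
      (hF.continuousOn (s := Icc α' β'))
    have hmq : F m < q := (hmin ht).trans_lt h
    have hmI : m ∈ Ioo α' β' :=
      ⟨lt_of_le_of_ne hm.1 fun h => by rw [← h] at hmq; linarith,
        lt_of_le_of_ne hm.2 fun h => by rw [h] at hmq; linarith⟩
    exact hreg m (Or.inl (hmin.isLocalMin (Icc_mem_nhds hmI.1 hmI.2)))
      ⟨hpos m ⟨h1.trans hmI.1, hmI.2.trans h3⟩, hmq⟩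
  have hinj : ∀ x y, Icc x y ⊆ Icc α β → (∀ t ∈ Ioo x y, F t < q) → InjOn F (Icc x y) := by
    intro x y hxy hq u hu v hv huv
    by_contra hne
    wlog hlt : u < v generalizing u v
    · exact this hv hu huv.symm (Ne.symm hne) (lt_of_le_of_ne (not_lt.1 hlt) (Ne.symm hne))
    obtain ⟨c, hc, hce⟩ := exists_isLocalExtr_Ioo hlt hF.continuousOn huv
    have hxα : α ≤ x := (hxy ⟨le_rfl, hu.1.trans hu.2⟩).1
    have hyβ : y ≤ β := (hxy ⟨hu.1.trans hu.2, le_rfl⟩).2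
    exact hreg c hce ⟨hpos c ⟨by linarith [hu.1, hc.1], by linarith [hv.2, hc.2]⟩,
      hq c ⟨by linarith [hu.1, hc.1], by linarith [hv.2, hc.2]⟩⟩
  have hmono : StrictMonoOn F (Icc α α') := by
    rcases hF.continuousOn.strictMonoOn_of_injOn_Icc' h1.le (hinj α α'
      (Icc_subset_Icc le_rfl (by linarith)) fun t ht => hlt₁ t ⟨ht.1.le, ht.2⟩) with h | h
    · exact h
    · have := h ⟨le_rfl, h1.le⟩ ⟨h1.le, le_rfl⟩ h1
      linarith
  have hanti : StrictAntiOn F (Icc β' β) := by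
    rcases hF.continuousOn.strictMonoOn_of_injOn_Icc' h3.le (hinj β' β
      (Icc_subset_Icc (by linarith) le_rfl) fun t ht => hlt₂ t ⟨ht.1, ht.2.le⟩) with h | h
    · have := h ⟨le_rfl, h3.le⟩ ⟨h3.le, le_rfl⟩ h3
      linarith
    · exact h
  set φ := levelHat F p q α β with hφ
  have hφI : ∀ t ∈ Icc α β, φ t = min (F t) q - p := by
    intro t ht
    by_cases hI : t ∈ Ioo α β
    · exact indicator_of_mem hI _
    · rw [hφ, levelHat, indicator_of_notMem hI]
      rcases eq_or_lt_of_le ht.1 with h | h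
      · rw [← h, hα, min_eq_left hpq.le, sub_self]
      · rcases eq_or_lt_of_le ht.2 with h' | h'
        · rw [h', hβ, min_eq_left hpq.le, sub_self]
        · exact absurd ⟨h, h'⟩ hI
  have hφ0 : ∀ t, t ∉ Ioo α β → φ t = 0 := fun t ht => indicator_of_notMem ht _
  have habs : ∀ t ∈ Icc α β, |φ t| = min (F t) q - p := by
    intro t ht
    rw [hφI t ht, abs_of_nonneg (sub_nonneg.2 (le_min (hge t ht) hpq.le))]
  have hs₁ : ∀ t ∈ Icc α α', |φ t| = F t - p := by
    intro t ht
    rw [habs t ⟨ht.1, by linarith [ht.2]⟩, min_eq_left (hle₁ t ht)]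
  have hs₂ : ∀ t ∈ Icc β' β, |φ t| = F t - p := by
    intro t ht
    rw [habs t ⟨by linarith [ht.1], ht.2⟩, min_eq_left (hle₂ t ht)]
  have hsm : ∀ t ∈ Icc α' β', φ t = q - p := by
    intro t ht
    rw [hφI t ⟨by linarith [ht.1], by linarith [ht.2]⟩, min_eq_right (hmid t ht)]
  refine ⟨α', β', ⟨⟨hαβ, ?_, hφ0, ?_, ?_⟩, h1, h2, h3, ?_, ?_, ?_⟩, ?_⟩
  · exact ContinuousOn.congr (by fun_prop) hφI
  · intro t ht
    rw [habs t (Ioo_subset_Icc_self ht)]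
    exact sub_pos.2 (lt_min (hpos t ht) hpq)
  · intro y hy hy'
    have hyq : y < q - p := by
      refine hy'.trans_le (csSup_le ((nonempty_Icc.2 hαβ.le).image _) ?_)
      rintro _ ⟨t, ht, rfl⟩
      simp only
      rw [habs t ht]
      linarith [min_le_right (F t) q]
    obtain ⟨x, hx, hxy⟩ := intermediate_value_Ioo h1.le (hF.continuousOn (s := Icc α α'))
      (show y + p ∈ Ioo (F α) (F α') by rw [hα, hα'e]; exact ⟨by linarith, by linarith⟩)
    obtain ⟨z, hz, hzy⟩ := intermediate_value_Ioo' h3.le (hF.continuousOn (s := Icc β' β))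
      (show y + p ∈ Ioo (F β) (F β') by rw [hβ, hβ'e]; exact ⟨by linarith, by linarith⟩)
    have hxz : x < z := by linarith [hx.2, hz.1]
    rw [← ncard_pair hxz.ne]
    congr 1
    ext t
    simp only [mem_ofPred_eq, mem_insert_iff, mem_singleton_iff]
    constructor
    · rintro ⟨htI, hty⟩
      rcases le_total t α' with h4 | h4
      · left
        rw [hs₁ t ⟨htI.1.le, h4⟩] at hty
        exact hmono.injOn ⟨htI.1.le, h4⟩ (Ioo_subset_Icc_self hx) (by linarith)
      rcases le_total t β' with h5 | h5
      · rw [hsm t ⟨h4, h5⟩, abs_of_pos (by linarith)] at hty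
        linarith
      · right
        rw [hs₂ t ⟨h5, htI.2.le⟩] at hty
        exact hanti.injOn ⟨h5, htI.2.le⟩ (Ioo_subset_Icc_self hz) (by linarith)
    · rintro (rfl | rfl)
      · exact ⟨⟨hx.1, by linarith [hx.2]⟩, by
          rw [hs₁ _ (Ioo_subset_Icc_self hx)]; linarith⟩
      · exact ⟨⟨by linarith [hz.1], hz.2⟩, by
          rw [hs₂ _ (Ioo_subset_Icc_self hz)]; linarith⟩
  · intro x hx y hy hxy
    simp only
    rw [hs₁ x hx, hs₁ y hy]
    linarith [hmono hx hy hxy]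
  · intro t ht
    rw [hsm t ht, hsm α' ⟨le_rfl, h2⟩]
  · intro x hx y hy hxy
    simp only
    rw [hs₂ x hx, hs₂ y hy]
    linarith [hanti hx hy hxy]
  · rintro t (ht | ht)
    · exact ⟨hpos t ⟨ht.1, by linarith [ht.2]⟩, hlt₁ t ⟨ht.1.le, ht.2⟩⟩
    · exact ⟨hpos t ⟨by linarith [ht.1], ht.2⟩, hlt₂ t ⟨ht.1, ht.2.le⟩⟩

/-- The height of a hat is the length of its set of levels below `F t`; summing hats thereby becomes
countable additivity of length. -/
theorem levelHat_eq_measureReal {F : ℝ → ℝ} {p q α β : ℝ} {t : ℝ} (hpq : p < q)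
    (hpos : ∀ t ∈ Ioo α β, p < F t) :
    levelHat F p q α β t = volume.real {y | y ∈ Ioo p q ∧ y < F t ∧ t ∈ Ioo α β} := by
  by_cases ht : t ∈ Ioo α β
  · have : {y | y ∈ Ioo p q ∧ y < F t ∧ t ∈ Ioo α β} = Ioo p (min (F t) q) := by
      ext y
      simp only [mem_ofPred_eq, mem_Ioo, lt_min_iff]
      exact ⟨fun h => ⟨h.1.1, h.2.1, h.1.2⟩, fun h => ⟨⟨h.1, h.2.2⟩, h.2.1, ht⟩⟩
    rw [levelHat, indicator_of_mem ht, this, Measure.real, Real.volume_Ioo, ENNReal.toReal_ofReal]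
    exact sub_nonneg.2 (le_min (hpos t ht).le hpq.le)
  · have : {y | y ∈ Ioo p q ∧ y < F t ∧ t ∈ Ioo α β} = ∅ := by
      ext y
      simp only [mem_ofPred_eq, mem_empty_iff_false, iff_false]
      exact fun h => ht h.2.2
    rw [levelHat, indicator_of_notMem ht, this, measureReal_empty]

/-- The positive part of a continuous function whose critical values form a null set is a sum of
hat functions. -/
theorem exists_hats_posPart {a b : ℝ} {F : ℝ → ℝ} (hF : Continuous F)
    (hF0 : ∀ t, t ∉ Ioo a b → F t = 0)
    (hN : volume (F '' (closure {t | IsLocalExtr F t} ∩ Icc a b)) = 0) :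
    ∃ (ι : Type) (_ : Countable ι) (α α' β' β : ι → ℝ) (φ : ι → ℝ → ℝ),
      (∀ k, a ≤ α k ∧ β k ≤ b ∧ IsHatWithIntervals (α k) (α' k) (β' k) (β k) (φ k)) ∧
      (∀ k, ∀ t ∈ Ioo (α k) (β k), 0 < F t) ∧ (∀ k t, 0 ≤ φ k t) ∧
      (∀ t, HasSum (fun k => φ k t) (max (F t) 0)) ∧
      (Pairwise fun p q : ι × Bool =>
        Disjoint
          (if p.2 then Ioo (α p.1) (α' p.1) else Ioo (β' p.1) (β p.1))
          (if q.2 then Ioo (α q.1) (α' q.1) else Ioo (β' q.1) (β q.1))) ∧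
      (∀ k, ∃ c : ℝ, ∀ t ∈ Ioo (α k) (α' k) ∪ Ioo (β' k) (β k), φ k t = F t + c) := by
  obtain ⟨H, hH0, hH⟩ : ∃ H, 0 < H ∧ ∀ t, F t < H := by
    obtain ⟨C, hC⟩ := (isCompact_Icc (a := a) (b := b)).exists_bound_of_continuousOn
      hF.continuousOn
    refine ⟨max C 0 + 1, by positivity, fun t => ?_⟩
    by_cases ht : t ∈ Ioo a b
    · have := (le_abs_self _).trans (hC t (Ioo_subset_Icc_self ht))
      linarith [le_max_left C 0]
    · rw [hF0 t ht]; positivity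
  set N := F '' (closure {t | IsLocalExtr F t} ∩ Icc a b) with hNdef
  have hNc : IsClosed N :=
    ((isCompact_Icc.inter_left isClosed_closure).image hF).isClosed
  set V := Ioo 0 H \ N with hV
  have hVo : IsOpen V := isOpen_Ioo.sdiff hNc
  have hVsub : V ⊆ Ioo 0 H := sdiff_subset
  have hV0 : ∀ p, IsOpenComponent V p → 0 ≤ p.1 := by
    intro p hp
    by_contra! h
    have h2 : 0 < p.2 := (hVsub (hp.2.1 (show (p.1 + p.2) / 2 ∈ Ioo p.1 p.2 from
      ⟨by linarith [hp.1], by linarith [hp.1]⟩))).1.trans (by linarith [hp.1])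
    exact lt_irrefl _ (hVsub (hp.2.1 ⟨h, h2⟩)).1
  have hUsub : ∀ p, 0 ≤ p → {t | p < F t} ⊆ Ioo a b := by
    intro p hp t ht
    by_contra hn
    rw [mem_ofPred_eq, hF0 t hn] at ht
    exact hp.not_gt ht
  -- A hat is indexed by a gap between critical levels and a component of the superlevel set at the
  -- bottom of that gap.
  let ι := {k : (ℝ × ℝ) × (ℝ × ℝ) // IsOpenComponent V k.1 ∧ IsOpenComponent {t | k.1.1 < F t} k.2}
  have hpos : ∀ k : ι, ∀ t ∈ Ioo k.1.2.1 k.1.2.2, k.1.1.1 < F t := fun k => k.2.2.2.1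
  have huniq : ∀ k l : ι, ∀ y, y ∈ Ioo k.1.1.1 k.1.1.2 → y ∈ Ioo l.1.1.1 l.1.1.2 →
      ∀ t, t ∈ Ioo k.1.2.1 k.1.2.2 → t ∈ Ioo l.1.2.1 l.1.2.2 → k = l := by
    rintro ⟨⟨k1, k2⟩, hk1, hk2⟩ ⟨⟨l1, l2⟩, hl1, hl2⟩ y hyk hyl t htk htl
    obtain rfl : k1 = l1 := hk1.eq hl1 hyk hyl
    obtain rfl : k2 = l2 := hk2.eq hl2 htk htl
    rfl
  have hcount : Countable ι := by
    have h1 : ∀ k : ι, ∃ q : ℚ, (q : ℝ) ∈ Ioo k.1.1.1 k.1.1.2 := fun k =>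
      exists_rat_btwn k.2.1.1
    have h2 : ∀ k : ι, ∃ q : ℚ, (q : ℝ) ∈ Ioo k.1.2.1 k.1.2.2 := fun k =>
      exists_rat_btwn k.2.2.1
    choose u hu using h1
    choose v hv using h2
    refine Function.Injective.countable (f := fun k => (u k, v k)) fun k l hkl => ?_
    obtain ⟨e1, e2⟩ := Prod.ext_iff.1 hkl
    simp only at e1 e2
    exact huniq k l (u k) (hu k) (e1 ▸ hu l) (v k) (hv k) (e2 ▸ hv l)
  have hhat : ∀ k : ι, ∃ α' β', IsHatWithIntervals k.1.2.1 α' β' k.1.2.2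
      (levelHat F k.1.1.1 k.1.1.2 k.1.2.1 k.1.2.2) ∧
      ∀ t ∈ Ioo k.1.2.1 α' ∪ Ioo β' k.1.2.2, F t ∈ Ioo k.1.1.1 k.1.1.2 := by
    intro k
    apply exists_isHatWithIntervals_levelHat hF k.2.1.1 k.2.2.1 (hpos k)
      (not_lt.1 k.2.2.2.2.1) (not_lt.1 k.2.2.2.2.2)
    intro t ht hmem
    have htV := k.2.1.2.1 hmem
    exact htV.2 ⟨t, ⟨subset_closure ht,
      Ioo_subset_Icc_self (hUsub _ (hV0 _ k.2.1) hmem.1)⟩, rfl⟩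
  choose α' β' hk hlev using hhat
  refine ⟨ι, hcount, fun k => k.1.2.1, α', β', fun k => k.1.2.2,
    fun k => levelHat F k.1.1.1 k.1.1.2 k.1.2.1 k.1.2.2, fun k => ⟨?_, ?_, hk k⟩, ?_, ?_, ?_, ?_, ?_⟩
  · by_contra! h
    have hm := hUsub _ (hV0 _ k.2.1) (hpos k _ (show (k.1.2.1 + min k.1.2.2 a) / 2 ∈ _ from
      ⟨by linarith [lt_min k.2.2.1 h],
        by linarith [min_le_left k.1.2.2 a, lt_min k.2.2.1 h]⟩))
    linarith [hm.1, min_le_right k.1.2.2 a]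
  · by_contra! h
    have hm := hUsub _ (hV0 _ k.2.1) (hpos k _ (show (max k.1.2.1 b + k.1.2.2) / 2 ∈ _ from
      ⟨by linarith [max_lt k.2.2.1 h, le_max_left k.1.2.1 b],
        by linarith [max_lt k.2.2.1 h]⟩))
    linarith [hm.2, le_max_right k.1.2.1 b]
  · exact fun k t ht => (hV0 _ k.2.1).trans_lt (hpos k t ht)
  · intro k t
    simp only
    rw [levelHat_eq_measureReal k.2.1.1 (hpos k)]
    exact measureReal_nonneg
  · intro t
    -- For fixed `t` the level sets `W k` partition the interval `(0, F t)` up to the null set `N`,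
    -- so their lengths sum to the positive part of `F t`.
    set W : ι → Set ℝ := fun k =>
      {y | y ∈ Ioo k.1.1.1 k.1.1.2 ∧ y < F t ∧ t ∈ Ioo k.1.2.1 k.1.2.2} with hW
    have hWm : ∀ k, MeasurableSet (W k) := by
      intro k
      exact (measurableSet_Ioo (a := k.1.1.1) (b := k.1.1.2)).inter
        ((measurableSet_Iio (a := F t)).inter (MeasurableSet.const (t ∈ Ioo k.1.2.1 k.1.2.2)))
    have hWd : Pairwise (Function.onFun Disjoint W) := by
      intro k l hkl
      rw [Function.onFun, Set.disjoint_left]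
      intro y hy hy'
      exact hkl (huniq k l y hy.1 hy'.1 t hy.2.2 hy'.2.2)
    have hWU : ⋃ k, W k = V ∩ Iio (F t) := by
      ext y
      simp only [mem_iUnion, mem_inter_iff, mem_Iio]
      constructor
      · rintro ⟨k, hy⟩
        exact ⟨k.2.1.2.1 hy.1, hy.2.1⟩
      · rintro ⟨hyV, hyt⟩
        obtain ⟨p, hp, hyp⟩ := exists_isOpenComponent hVo hVsub hyV
        obtain ⟨q, hq, htq⟩ := exists_isOpenComponent (isOpen_lt continuous_const hF)
          (hUsub p.1 (hV0 p hp)) (show t ∈ {t | p.1 < F t} from hyp.1.trans hyt)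
        exact ⟨⟨(p, q), hp, hq⟩, hyp, hyt, htq⟩
    have hvol : volume (⋃ k, W k) = ENNReal.ofReal (max (F t) 0) := by
      have e1 : V ∩ Iio (F t) = Ioo 0 (F t) \ N := by
        ext y
        simp only [hV, mem_inter_iff, Set.mem_sdiff, mem_Ioo, mem_Iio]
        exact ⟨fun h => ⟨⟨h.1.1.1, h.2⟩, h.1.2⟩, fun h => ⟨⟨⟨h.1.1, h.1.2.trans (hH t)⟩, h.2⟩, h.1.2⟩⟩
      rw [hWU, e1, measure_sdiff_null hN, Real.volume_Ioo, sub_zero]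
      rcases le_total (F t) 0 with h | h
      · rw [max_eq_right h, ENNReal.ofReal_zero, ENNReal.ofReal_of_nonpos h]
      · rw [max_eq_left h]
    rw [measure_iUnion hWd hWm] at hvol
    have hs := ENNReal.hasSum_toReal (f := fun k => volume (W k)) (by rw [hvol]; simp)
    rw [← ENNReal.tsum_toReal_eq, hvol, ENNReal.toReal_ofReal (le_max_right _ _)] at hs
    · convert hs using 2 with k
      exact levelHat_eq_measureReal k.2.1.1 (hpos k)
    · intro k
      exact ENNReal.ne_top_of_tsum_ne_top (by rw [hvol]; simp) k
  · have hsub : ∀ p : ι × Bool, ∀ t, t ∈ (if p.2 then Ioo p.1.1.2.1 (α' p.1)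
        else Ioo (β' p.1) p.1.1.2.2) →
        t ∈ Ioo p.1.1.2.1 p.1.1.2.2 ∧ F t ∈ Ioo p.1.1.1.1 p.1.1.1.2 := by
      rintro ⟨k, _ | _⟩ t ht
      · have ht' : t ∈ Ioo (β' k) k.1.2.2 := ht
        exact ⟨⟨by linarith [(hk k).lt_left, (hk k).le_mid, ht'.1], ht'.2⟩, hlev k t (Or.inr ht')⟩
      · have ht' : t ∈ Ioo k.1.2.1 (α' k) := ht
        exact ⟨⟨ht'.1, by linarith [(hk k).lt_right, (hk k).le_mid, ht'.2]⟩, hlev k t (Or.inl ht')⟩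
    intro p q hpq
    rw [Set.disjoint_left]
    intro t htp htq
    obtain ⟨p1, p2⟩ := hsub p t htp
    obtain ⟨q1, q2⟩ := hsub q t htq
    have hpq1 := huniq p.1 q.1 (F t) p2 q2 t p1 q1
    obtain ⟨k, bp⟩ := p
    obtain ⟨l, bq⟩ := q
    simp only at hpq1
    subst hpq1
    have hmid := (hk k).le_mid
    cases bp <;> cases bq <;> simp at htp htq hpq
    · linarith [htp.1, htq.2]
    · linarith [htp.2, htq.1]
  · intro k
    -- On the monotone parts `F` stays below the upper level, so the truncation is inactive and the
    -- hat is `F` minus the lower level.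
    refine ⟨-k.1.1.1, fun t ht => ?_⟩
    have htI : t ∈ Ioo k.1.2.1 k.1.2.2 := by
      rcases ht with ht | ht
      · exact ⟨ht.1, by linarith [(hk k).lt_right, (hk k).le_mid, ht.2]⟩
      · exact ⟨by linarith [(hk k).lt_left, (hk k).le_mid, ht.1], ht.2⟩
    simp only [levelHat]
    rw [indicator_of_mem htI, min_eq_left (hlev k t ht).2.le, sub_eq_add_neg]

/-! ### Critical values form a null set -/

theorem LipschitzOnWith.volume_image_eq_zero {K : NNReal} {f : ℝ → ℝ} {s : Set ℝ}
    (hf : LipschitzOnWith K f s) (hs : volume s = 0) : volume (f '' s) = 0 := by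
  have := hf.hausdorffMeasure_image_le (d := 1) zero_le_one
  rw [hausdorffMeasure_real, hs, mul_zero] at this
  exact le_antisymm this zero_le

/-- If an indefinite integral of a regulated function is differentiable at a limit of local
extrema, then its derivative vanishes there. -/
theorem hasDerivAt_zero_of_mem_closure_isLocalExtr {a b t d : ℝ} {ψ F : ℝ → ℝ}
    (hψ : IntervalIntegrable ψ volume a b)
    (hr : ∀ t ∈ Ico a b, ∃ l : ℝ, Tendsto ψ (𝓝[>] t) (𝓝 l))
    (hl : ∀ t ∈ Ioc a b, ∃ l : ℝ, Tendsto ψ (𝓝[<] t) (𝓝 l))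
    (hF : ∀ t ∈ Icc a b, F t = ∫ u in a..t, ψ u) (ht : t ∈ Ioo a b)
    (htc : t ∈ closure {t | IsLocalExtr F t}) (hd : HasDerivAt F d t) : d = 0 := by
  have hab : a ≤ b := (ht.1.trans ht.2).le
  have hFe : F =ᶠ[𝓝 t] fun x => ∫ u in a..x, ψ u := by
    filter_upwards [Ioo_mem_nhds ht.1 ht.2] with x hx using hF x (Ioo_subset_Icc_self hx)
  have hd' : HasDerivAt (fun x => ∫ u in a..x, ψ u) d t := hd.congr_of_eventuallyEq hFe.symm
  have hsubI : ∀ x ∈ Icc a b, ∀ y ∈ Icc a b, IntervalIntegrable ψ volume x y :=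
    fun x hx y hy => hψ.mono_set (by
      rw [uIcc_of_le hab]; exact uIcc_subset_Icc hx hy)
  have haI : a ∈ Icc a b := ⟨le_rfl, hab⟩
  have hψt := hsubI a haI t (Ioo_subset_Icc_self ht)
  have hmeas : AEStronglyMeasurable ψ (volume.restrict (Ioo a b)) :=
    (((intervalIntegrable_iff_integrableOn_Ioc_of_le hab).1 hψ).mono_set
      Ioo_subset_Ioc_self).aestronglyMeasurable
  -- A one-sided limit of `ψ` is the one-sided derivative of its primitive, so both one-sided limits
  -- at `t` equal `d`.
  have hr' : Tendsto ψ (𝓝[>] t) (𝓝 d) := by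
    obtain ⟨l, h⟩ := hr t ⟨ht.1.le, ht.2⟩
    have h1 : HasDerivWithinAt (fun x => ∫ u in a..x, ψ u) l (Ici t) t :=
      intervalIntegral.integral_hasDerivWithinAt_of_tendsto_ae_right hψt (t := Ioi t)
        ⟨Ioo a b, mem_nhdsWithin_of_mem_nhds (Ioo_mem_nhds ht.1 ht.2), hmeas⟩
        (h.mono_left inf_le_left)
    rwa [(uniqueDiffWithinAt_Ici t).eq_deriv _ hd'.hasDerivWithinAt h1]
  have hl' : Tendsto ψ (𝓝[<] t) (𝓝 d) := by
    obtain ⟨l, h⟩ := hl t ⟨ht.1, ht.2.le⟩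
    have h1 : HasDerivWithinAt (fun x => ∫ u in a..x, ψ u) l (Iic t) t :=
      intervalIntegral.integral_hasDerivWithinAt_of_tendsto_ae_right hψt (t := Iic t)
        ⟨Ioo a b, mem_nhdsWithin_of_mem_nhds (Ioo_mem_nhds ht.1 ht.2), hmeas⟩ (by
          rw [← Iio_union_right, nhdsWithin_union, inf_sup_right, tendsto_sup]
          refine ⟨h.mono_left inf_le_left, ?_⟩
          -- The closed half-line includes `t`, where the value of `ψ` is uncontrolled; a single
          -- point is null and contributes the trivial filter.
          have : 𝓝[{t}] t ⊓ ae (volume : Measure ℝ) = ⊥ := by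
            rw [nhdsWithin_singleton, ← Filter.principal_singleton, ← _root_.disjoint_iff,
              Filter.disjoint_principal_left, mem_ae_iff, compl_compl, measure_singleton]
          rw [this]
          exact tendsto_bot)
    rwa [(uniqueDiffWithinAt_Iic t).eq_deriv _ hd'.hasDerivWithinAt h1]
  -- If `d ≠ 0`, the difference quotients of `F` near `t` stay within `|d| / 2` of `d`. So `F` is
  -- strictly monotone there and has no local extremum `s` close to `t`.
  by_contra hd0
  have hpun : Tendsto ψ (𝓝[≠] t) (𝓝 d) := by
    rw [← Iio_union_Ioi, nhdsWithin_union]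
    exact hl'.sup hr'
  have hev : ∀ᶠ x in 𝓝[≠] t, |ψ x - d| ≤ |d| / 2 := by
    filter_upwards [hpun (Metric.closedBall_mem_nhds d (half_pos (abs_pos.2 hd0)))] with x hx
    exact hx
  obtain ⟨ε, hε, hball⟩ := Metric.mem_nhdsWithin_iff.1 hev
  obtain ⟨s, hs, hse⟩ := mem_closure_iff_nhds.1 htc (Ioo a b ∩ Metric.ball t ε)
    (inter_mem (Ioo_mem_nhds ht.1 ht.2) (Metric.ball_mem_nhds t hε))
  have hne : ∀ᵐ x : ℝ, x ≠ t := by simp [ae_iff, measure_singleton]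
  have hkey : ∀ x ∈ Ioo a b ∩ Metric.ball t ε, ∀ y ∈ Ioo a b ∩ Metric.ball t ε,
      |F y - F x - d * (y - x)| ≤ |d| / 2 * |y - x| := by
    intro x hx y hy
    have hx' := Ioo_subset_Icc_self hx.1
    have hy' := Ioo_subset_Icc_self hy.1
    have e1 : F y - F x - d * (y - x) = ∫ u in x..y, (ψ u - d) := by
      rw [hF x hx', hF y hy', intervalIntegral.integral_interval_sub_left (hsubI a haI y hy')
        (hsubI a haI x hx'), intervalIntegral.integral_sub (hsubI x hx' y hy')
        (intervalIntegrable_const), intervalIntegral.integral_const, smul_eq_mul]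
      ring
    rw [e1]
    apply intervalIntegral.norm_integral_le_of_norm_le_const_ae (f := fun u => ψ u - d)
    filter_upwards [hne] with u hu hmem
    have hub : u ∈ Metric.ball t ε := by
      have hc : Convex ℝ (Metric.ball t ε) := convex_ball t ε
      exact hc.ordConnected.uIcc_subset hx.2 hy.2 (uIoc_subset_uIcc hmem)
    exact hball ⟨hub, hu⟩
  have hnear : ∀ᶠ y in 𝓝 s, y ∈ Ioo a b ∩ Metric.ball t ε :=
    (isOpen_Ioo.inter Metric.isOpen_ball).mem_nhds hs
  have hright : ∀ᶠ y in 𝓝[>] s, 0 < (F y - F s) * d := by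
    filter_upwards [nhdsWithin_le_nhds hnear, self_mem_nhdsWithin] with y hy hsy
    have h1 := hkey s hs y hy
    have hys : 0 < y - s := sub_pos.2 hsy
    rw [abs_of_pos hys] at h1
    have h2 := abs_le.1 h1
    rcases lt_or_gt_of_ne hd0 with h | h
    · rw [abs_of_neg h] at h2
      have : F y - F s < 0 := by nlinarith
      exact mul_pos_of_neg_of_neg this h
    · rw [abs_of_pos h] at h2
      have : 0 < F y - F s := by nlinarith
      exact mul_pos this h
  have hleft : ∀ᶠ y in 𝓝[<] s, (F y - F s) * d < 0 := by
    filter_upwards [nhdsWithin_le_nhds hnear, self_mem_nhdsWithin] with y hy hsy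
    have h1 := hkey s hs y hy
    have hys : y - s < 0 := sub_neg.2 hsy
    rw [abs_of_neg hys] at h1
    have h2 := abs_le.1 h1
    rcases lt_or_gt_of_ne hd0 with h | h
    · rw [abs_of_neg h] at h2
      have : 0 < F y - F s := by nlinarith
      exact mul_neg_of_pos_of_neg this h
    · rw [abs_of_pos h] at h2
      have : F y - F s < 0 := by nlinarith
      exact mul_neg_of_neg_of_pos this h
  rcases hse with hmin | hmax
  · obtain ⟨y, hy, hy'⟩ := (hright.and (nhdsWithin_le_nhds hmin)).exists
    obtain ⟨z, hz, hz'⟩ := (hleft.and (nhdsWithin_le_nhds hmin)).exists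
    have hd1 : 0 < d := by
      by_contra! h
      nlinarith [mul_nonneg (sub_nonneg.2 hy') (neg_nonneg.2 h)]
    nlinarith [mul_nonneg (sub_nonneg.2 hz') hd1.le]
  · obtain ⟨y, hy, hy'⟩ := (hright.and (nhdsWithin_le_nhds hmax)).exists
    obtain ⟨z, hz, hz'⟩ := (hleft.and (nhdsWithin_le_nhds hmax)).exists
    have hd1 : d < 0 := by
      by_contra! h
      nlinarith [mul_nonneg (sub_nonneg.2 hy') h]
    nlinarith [mul_nonneg (sub_nonneg.2 hz') (neg_nonneg.2 hd1.le)]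

/-- On `A` the derivative vanishes, so the image is null; `B` is null because `F` is Lipschitz, and
Lipschitz maps preserve null sets. Taking the closure of the extrema makes the set of excluded
levels compact, so that its complement splits into open gaps. -/
theorem volume_image_closure_isLocalExtr {a b M : ℝ} {ψ F : ℝ → ℝ} (hab : a ≤ b) (hM0 : 0 ≤ M)
    (hψ : IntervalIntegrable ψ volume a b) (hM : ∀ t ∈ Icc a b, |ψ t| ≤ M)
    (hr : ∀ t ∈ Ico a b, ∃ l : ℝ, Tendsto ψ (𝓝[>] t) (𝓝 l))
    (hl : ∀ t ∈ Ioc a b, ∃ l : ℝ, Tendsto ψ (𝓝[<] t) (𝓝 l))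
    (hF : ∀ t ∈ Icc a b, F t = ∫ u in a..t, ψ u) :
    volume (F '' (closure {t | IsLocalExtr F t} ∩ Icc a b)) = 0 := by
  have hL := lipschitzOnWith_of_integral hM0 hψ hM hF
  set K := closure {t | IsLocalExtr F t} with hK
  set A := {t | t ∈ K ∧ t ∈ Ioo a b ∧ DifferentiableAt ℝ F t} with hA
  set B := {t | t ∈ Icc a b ∧ ¬ (t ∈ Ioo a b ∧ DifferentiableAt ℝ F t)} with hB
  have hA0 : volume (F '' A) = 0 := by
    apply addHaar_image_eq_zero_of_det_fderivWithin_eq_zero volume (f' := fun _ => 0)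
    · intro t ht
      have hd := ht.2.2.hasDerivAt
      rw [hasDerivAt_zero_of_mem_closure_isLocalExtr hψ hr hl hF ht.2.1 ht.1 hd] at hd
      have := hd.hasDerivWithinAt (s := A) |>.hasFDerivWithinAt
      simpa using this
    · intro t _
      simp
  have hB0 : volume (F '' B) = 0 := by
    apply (hL.mono fun t ht => ht.1).volume_image_eq_zero
    have hac : AbsolutelyContinuousOnInterval F a b := by
      apply LipschitzOnWith.absolutelyContinuousOnInterval (K := M.toNNReal)
      rwa [uIcc_of_le hab]
    have h1 : ∀ᵐ t : ℝ, t ≠ a := by simp [ae_iff, measure_singleton]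
    have h2 : ∀ᵐ t : ℝ, t ≠ b := by simp [ae_iff, measure_singleton]
    have : ∀ᵐ t, t ∉ B := by
      filter_upwards [hac.ae_differentiableAt, h1, h2] with t ht hta htb hmem
      rw [uIcc_of_le hab] at ht
      exact hmem.2 ⟨⟨lt_of_le_of_ne hmem.1.1 (Ne.symm hta), lt_of_le_of_ne hmem.1.2 htb⟩,
        ht hmem.1⟩
    exact measure_eq_zero_iff_ae_notMem.2 this
  refine measure_mono_null ?_ (measure_union_null hA0 hB0)
  rw [← image_union]
  apply image_mono
  rintro t ⟨ht, htI⟩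
  by_cases h : t ∈ Ioo a b ∧ DifferentiableAt ℝ F t
  · exact Or.inl ⟨ht, h.1, h.2⟩
  · exact Or.inr ⟨htI, h⟩

/-! ### Existence of a `Σ`-representation -/

theorem IsHatWithIntervals.neg {α α' β' β : ℝ} {φ : ℝ → ℝ} (h : IsHatWithIntervals α α' β' β φ) :
    IsHatWithIntervals α α' β' β fun t => -φ t where
  isHat :=
    { lt := h.isHat.lt
      continuousOn := h.isHat.continuousOn.neg
      eq_zero := fun t ht => by rw [h.isHat.eq_zero t ht, neg_zero]
      abs_pos := fun t ht => by rw [abs_neg]; exact h.isHat.abs_pos t ht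
      two_roots := by simpa only [abs_neg] using h.isHat.two_roots }
  lt_left := h.lt_left
  le_mid := h.le_mid
  lt_right := h.lt_right
  strictMonoOn := by simpa only [abs_neg] using h.strictMonoOn
  const := fun t ht => by rw [h.const t ht]
  strictAntiOn := by simpa only [abs_neg] using h.strictAntiOn

/-- The positive and negative parts are cut separately. Their hats live where `Ψ > 0` and `Ψ < 0`
respectively, so the intervals stay disjoint and the absolute values add up. -/
theorem exists_isSigmaRepresentation {a b M : ℝ} {ψ Ψ : ℝ → ℝ} (hab : a < b)
    (hψ : IntervalIntegrable ψ volume a b) (hM : ∀ t ∈ Icc a b, |ψ t| ≤ M) (hD : IsD0 a b ψ)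
    (hΨ : ∀ t ∈ Icc a b, Ψ t = ∫ u in a..t, ψ u) :
    ∃ (ι : Type) (_ : Countable ι) (φ : ι → ℝ → ℝ), IsSigmaRepresentation a b Ψ φ := by
  have hM0 : 0 ≤ M := (abs_nonneg _).trans (hM a ⟨le_rfl, hab.le⟩)
  have hL := lipschitzOnWith_of_integral hM0 hψ hM hΨ
  -- The extension by clamping is continuous on the line and vanishes off the segment, because `Ψ`
  -- is zero at `a` and, by the mean value condition, at `b`.
  set F : ℝ → ℝ := fun t => Ψ (max a (min b t)) with hFdef
  have hFΨ : ∀ t ∈ Icc a b, F t = Ψ t := by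
    intro t ht
    rw [hFdef]
    simp only
    rw [min_eq_right ht.2, max_eq_right ht.1]
  have hF : ∀ t ∈ Icc a b, F t = ∫ u in a..t, ψ u := fun t ht => (hFΨ t ht).trans (hΨ t ht)
  have hFc : Continuous F := hL.continuousOn.comp_continuous (by fun_prop) fun t =>
    ⟨le_max_left _ _, max_le hab.le (min_le_left _ _)⟩
  have hF0 : ∀ t, t ∉ Ioo a b → F t = 0 := by
    intro t ht
    rcases le_or_gt t a with h | h
    · rw [hFdef]
      simp only
      rw [min_eq_right (h.trans hab.le), max_eq_left h, hΨ a ⟨le_rfl, hab.le⟩,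
        intervalIntegral.integral_same]
    · have h' : b ≤ t := not_lt.1 fun hh => ht ⟨h, hh⟩
      rw [hFdef]
      simp only
      rw [min_eq_left h', max_eq_right hab.le, hΨ b ⟨hab.le, le_rfl⟩, hD.integral_eq_zero]
  have hN := volume_image_closure_isLocalExtr hab.le hM0 hψ hM hD.right_limit hD.left_limit hF
  have hN' : volume ((fun t => -F t) '' (closure {t | IsLocalExtr (fun t => -F t) t} ∩ Icc a b))
      = 0 := by
    have e1 : {t | IsLocalExtr (fun t => -F t) t} = {t | IsLocalExtr F t} := by
      ext t
      exact ⟨fun h => by simpa using h.neg, fun h => h.neg⟩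
    rw [e1, ← image_image (fun x : ℝ => -x) F]
    exact ((LipschitzWith.id.neg : LipschitzWith 1 fun x : ℝ => -x).lipschitzOnWith
      (s := _)).volume_image_eq_zero hN
  obtain ⟨ι, hι, α, α', β', β, φ, hk, hpos, hφ, hsum, hdisj, hc⟩ :=
    exists_hats_posPart hFc hF0 hN
  obtain ⟨κ, hκ, γ, γ', δ', δ, χ, hk2, hpos2, hχ, hsum2, hdisj2, hc2⟩ :=
    exists_hats_posPart (F := fun t => -F t) hFc.neg (fun t ht => by rw [hF0 t ht, neg_zero]) hN'
  refine ⟨ι ⊕ κ, inferInstance, Sum.elim φ (fun k t => -χ k t), Sum.elim α γ, Sum.elim α' γ',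
    Sum.elim β' δ', Sum.elim β δ, ?_, ?_, ?_, ?_, ?_⟩
  · rintro (k | k)
    · exact hk k
    · exact ⟨(hk2 k).1, (hk2 k).2.1, (hk2 k).2.2.neg⟩
  · intro t ht
    rw [← hFΨ t ht, ← max_zero_sub_max_neg_zero_eq_self (F t), sub_eq_add_neg]
    apply HasSum.sum
    · exact hsum t
    · exact (hsum2 t).neg
  · intro t ht
    rw [← hFΨ t ht, ← max_zero_add_max_neg_zero_eq_abs_self (F t)]
    apply HasSum.sum
    · simpa only [Function.comp_def, Sum.elim_inl, abs_of_nonneg (hφ _ _)] using hsum t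
    · simpa only [Function.comp_def, Sum.elim_inr, abs_neg, abs_of_nonneg (hχ _ _)] using hsum2 t
  · have hs1 : ∀ k (c : Bool) t, t ∈ (if c then Ioo (α k) (α' k) else Ioo (β' k) (β k)) →
        0 < F t := by
      intro k c t ht
      have hh := (hk k).2.2
      apply hpos k
      cases c
      · exact ⟨by linarith [hh.lt_left, hh.le_mid, ht.1], ht.2⟩
      · exact ⟨ht.1, by linarith [hh.lt_right, hh.le_mid, ht.2]⟩
    have hs2 : ∀ k (c : Bool) t, t ∈ (if c then Ioo (γ k) (γ' k) else Ioo (δ' k) (δ k)) →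
        0 < -F t := by
      intro k c t ht
      have hh := (hk2 k).2.2
      apply hpos2 k
      cases c
      · exact ⟨by linarith [hh.lt_left, hh.le_mid, ht.1], ht.2⟩
      · exact ⟨ht.1, by linarith [hh.lt_right, hh.le_mid, ht.2]⟩
    rintro ⟨k | k, c⟩ ⟨l | l, d⟩ hne
    · exact hdisj (i := (k, c)) (j := (l, d)) fun h => hne (by
        rw [Prod.ext_iff] at h ⊢; exact ⟨congrArg Sum.inl h.1, h.2⟩)
    · exact Set.disjoint_left.2 fun t h1 h2 => by linarith [hs1 k c t h1, hs2 l d t h2]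
    · exact Set.disjoint_left.2 fun t h1 h2 => by linarith [hs2 k c t h1, hs1 l d t h2]
    · exact hdisj2 (i := (k, c)) (j := (l, d)) fun h => hne (by
        rw [Prod.ext_iff] at h ⊢; exact ⟨congrArg Sum.inr h.1, h.2⟩)
  · rintro (k | k)
    · obtain ⟨c, h⟩ := hc k
      refine ⟨c, fun t ht => ?_⟩
      simp only [Sum.elim_inl] at ht ⊢
      rw [← hFΨ t]
      · exact h t ht
      · have hh := (hk k).2.2
        have h1 := hh.lt_left; have h2 := hh.le_mid; have h3 := hh.lt_right
        rcases ht with ht | ht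
        · exact ⟨by linarith [(hk k).1, ht.1], by linarith [(hk k).2.1, ht.2]⟩
        · exact ⟨by linarith [(hk k).1, ht.1], by linarith [(hk k).2.1, ht.2]⟩
    · obtain ⟨c, h⟩ := hc2 k
      refine ⟨-c, fun t ht => ?_⟩
      simp only [Sum.elim_inr] at ht ⊢
      rw [← hFΨ t]
      · linarith [h t ht]
      · have hh := (hk2 k).2.2
        have h1 := hh.lt_left; have h2 := hh.le_mid; have h3 := hh.lt_right
        rcases ht with ht | ht
        · exact ⟨by linarith [(hk2 k).1, ht.1], by linarith [(hk2 k).2.1, ht.2]⟩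
        · exact ⟨by linarith [(hk2 k).1, ht.1], by linarith [(hk2 k).2.1, ht.2]⟩

/-! ### Convex elements and the Hahn-Banach functional -/

theorem nsmul_eq_smul_of_mem_convexElements {X : Type*} [AddCommMonoid X]
    [DistribMulAction ℝ X] {x : X} (hx : x ∈ convexElements X)
    (h0 : (0 : ℝ) • x = 0) (n : ℕ) : n • x = (n : ℝ) • x := by
  induction n with
  | zero => simp [h0]
  | succ n ih =>
    rw [succ_nsmul, ih, Nat.cast_succ, hx n 1 n.cast_nonneg zero_le_one, one_smul]

/-- The positive part of a finitely supported function. -/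
noncomputable def finsuppPosPart {X : Type*} (v : X →₀ ℝ) : X →₀ NNReal :=
  v.mapRange Real.toNNReal Real.toNNReal_zero

theorem finsuppPosPart_sub {X : Type*} (v : X →₀ ℝ) (x : X) :
    v x = (finsuppPosPart v x : ℝ) - finsuppPosPart (-v) x := by
  simp only [finsuppPosPart, Finsupp.mapRange_apply, Finsupp.neg_apply, Real.coe_toNNReal']
  exact (max_zero_sub_max_neg_zero_eq_self _).symm

section LSpace

variable {X : Type*} [AddCommMonoid X] [DistribMulAction ℝ X] [MetricSpace X]

theorem IsConvexifying.apply_mem {P : X → X} (hP : IsConvexifying P) (x : X) :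
    P x ∈ convexElements X := by
  rw [← hP.range_eq]
  exact mem_range_self x

theorem IsConvexifying.apply_add {P : X → X} (hP : IsConvexifying P) (x y : X) :
    P (x + y) = P x + P y := by
  simpa using hP.map_add_smul 1 1 x y

theorem IsConvexifying.continuous {P : X → X} (hP : IsConvexifying P) : Continuous P :=
  (LipschitzWith.of_dist_le_mul (K := 1) (by simpa using hP.dist_le)).continuous

variable [IsLSpace X]

theorem IsConvexifying.apply_smul {P : X → X} (hP : IsConvexifying P) (c : ℝ) (x : X) :
    P (c • x) = c • P x := by
  simpa [IsLSpace.zero_smul] using hP.map_add_smul c 0 x x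

theorem IsConvexifying.apply_zero {P : X → X} (hP : IsConvexifying P) : P 0 = 0 := by
  have := hP.apply_smul 0 0
  rwa [IsLSpace.zero_smul, IsLSpace.zero_smul] at this

theorem dist_add_add_le_of_isLSpace (x y z w : X) :
    dist (x + y) (z + w) ≤ dist x z + dist y w := by
  refine (dist_triangle _ (z + y) _).trans (add_le_add (IsLSpace.dist_add_le x z y) ?_)
  rw [add_comm z y, add_comm z w]
  exact IsLSpace.dist_add_le y w z

/-- The metric is translation invariant on convex elements. -/
theorem dist_add_right_of_mem_convexElements {x y z : X} (hx : x ∈ convexElements X)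
    (hy : y ∈ convexElements X) : dist (x + z) (y + z) = dist x y := by
  apply le_antisymm (IsLSpace.dist_add_le x y z)
  -- The copies of `x` are exchanged for copies of `y` one at a time, with a single `z` reused as a
  -- catalyst in each exchange.
  have key : ∀ n : ℕ, dist (n • x + z) (n • y + z) ≤ n * dist (x + z) (y + z) := by
    intro n
    induction n with
    | zero => simp
    | succ n ih =>
      have h1 : dist ((n + 1) • x + z) (n • x + (y + z)) ≤ dist (x + z) (y + z) := by
        rw [succ_nsmul, add_assoc, add_comm (n • x), add_comm (n • x)]
        exact IsLSpace.dist_add_le _ _ _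
      have h2 : dist (n • x + (y + z)) ((n + 1) • y + z) ≤ n * dist (x + z) (y + z) := by
        refine le_trans ?_ ih
        rw [succ_nsmul, add_comm y z, ← add_assoc, add_assoc (n • y), add_comm y z, ← add_assoc]
        exact IsLSpace.dist_add_le _ _ _
      push_cast
      linarith [dist_triangle ((n + 1) • x + z) (n • x + (y + z)) ((n + 1) • y + z)]
  -- Convexity gives `n • x = (n : ℝ) • x`, so `dist x y` is scaled by `n`, while inserting and
  -- removing `z` costs a bounded amount that disappears after division by `n`.
  have key2 : ∀ n : ℕ, 0 < n → dist x y ≤ dist (x + z) (y + z) + 2 * dist z 0 * (n : ℝ)⁻¹ := by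
    intro n hn
    have hn' : (0 : ℝ) < n := by exact_mod_cast hn
    have h1 := key n
    rw [nsmul_eq_smul_of_mem_convexElements hx (IsLSpace.zero_smul x),
      nsmul_eq_smul_of_mem_convexElements hy (IsLSpace.zero_smul y)] at h1
    have h2 : dist ((n : ℝ) • x) ((n : ℝ) • x + z) ≤ dist z 0 := by
      have := IsLSpace.dist_add_le 0 z ((n : ℝ) • x)
      rwa [zero_add, add_comm z, dist_comm 0 z] at this
    have h3 : dist ((n : ℝ) • y + z) ((n : ℝ) • y) ≤ dist z 0 := by
      have := IsLSpace.dist_add_le z 0 ((n : ℝ) • y)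
      rwa [zero_add, add_comm z] at this
    have h4 := IsLSpace.dist_smul (n : ℝ) x y
    rw [abs_of_pos hn'] at h4
    have h5 := dist_triangle4 ((n : ℝ) • x) ((n : ℝ) • x + z) ((n : ℝ) • y + z) ((n : ℝ) • y)
    have h6 : (n : ℝ) * dist x y ≤ n * (dist (x + z) (y + z) + 2 * dist z 0 * (n : ℝ)⁻¹) := by
      rw [mul_add, mul_comm (2 * dist z 0), ← mul_assoc, mul_inv_cancel₀ hn'.ne', one_mul]
      linarith
    exact le_of_mul_le_mul_left h6 hn'
  have hlim : Tendsto (fun n : ℕ => dist (x + z) (y + z) + 2 * dist z 0 * (n : ℝ)⁻¹) atTop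
      (𝓝 (dist (x + z) (y + z))) := by
    have := (tendsto_inv_atTop_nhds_zero_nat (𝕜 := ℝ)).const_mul (2 * dist z 0)
    simpa using this.const_add (dist (x + z) (y + z))
  exact ge_of_tendsto hlim (eventually_atTop.2 ⟨1, fun n hn => key2 n hn⟩)

theorem dist_smul_smul_of_mem_convexElements {x : X} (hx : x ∈ convexElements X) {s t : ℝ}
    (hs : 0 ≤ s) (hst : s ≤ t) : dist (s • x) (t • x) ≤ (t - s) * dist x 0 := by
  have h1 : t • x = (t - s) • x + s • x := by
    rw [← hx _ _ (sub_nonneg.2 hst) hs, sub_add_cancel]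
  have h2 := IsLSpace.dist_add_le 0 ((t - s) • x) (s • x)
  rw [zero_add, ← h1] at h2
  refine h2.trans (le_of_eq ?_)
  have h3 := IsLSpace.dist_smul (t - s) x 0
  rwa [smul_zero, abs_of_nonneg (sub_nonneg.2 hst), dist_comm] at h3

open NNReal in
/-- The combination `∑ w x • P x` with non-negative coefficients. -/
noncomputable def convexComb {P : X → X} (hP : IsConvexifying P) : (X →₀ ℝ≥0) →+ X :=
  Finsupp.liftAddHom fun x =>
    { toFun := fun c => (c : ℝ) • P x
      map_zero' := by simp [IsLSpace.zero_smul]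
      map_add' := fun c d => by
        exact (congrArg (· • P x) (NNReal.coe_add c d)).trans (hP.apply_mem x _ _ c.2 d.2) }

theorem convexComb_single {P : X → X} (hP : IsConvexifying P) (x : X) (c : NNReal) :
    convexComb hP (Finsupp.single x c) = (c : ℝ) • P x := by
  simp [convexComb, IsLSpace.zero_smul]

theorem apply_convexComb {P : X → X} (hP : IsConvexifying P) (w : X →₀ NNReal) :
    P (convexComb hP w) = convexComb hP w := by
  induction w using Finsupp.induction_linear with
  | zero => simp [hP.apply_zero]
  | add v w hv hw => rw [map_add, hP.apply_add, hv, hw]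
  | single x c => rw [convexComb_single, hP.apply_smul, hP.idem]

theorem convexComb_mem {P : X → X} (hP : IsConvexifying P) (w : X →₀ NNReal) :
    convexComb hP w ∈ convexElements X := by
  rw [← apply_convexComb]
  exact hP.apply_mem _

theorem convexComb_smul {P : X → X} (hP : IsConvexifying P) (c : NNReal) (w : X →₀ NNReal) :
    convexComb hP (c • w) = (c : ℝ) • convexComb hP w := by
  induction w using Finsupp.induction_linear with
  | zero => simp
  | add v w hv hw => rw [smul_add, map_add, hv, hw, map_add, smul_add]
  | single x d =>
    rw [Finsupp.smul_single, convexComb_single, convexComb_single, smul_eq_mul, NNReal.coe_mul,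
      mul_smul]

/-- The distance between the positive and the negative part of a formal combination. -/
noncomputable def combDist {P : X → X} (hP : IsConvexifying P) (v : X →₀ ℝ) : ℝ :=
  dist (convexComb hP (finsuppPosPart v)) (convexComb hP (finsuppPosPart (-v)))

/-- Two decompositions of `v` agree after adding a convex element to each side, and translation
invariance removes it again, in place of a cancellation law. This freedom of decomposition makes
`combDist` sublinear. -/
theorem combDist_eq {P : X → X} (hP : IsConvexifying P) {v : X →₀ ℝ} {p q : X →₀ NNReal}
    (h : ∀ x, v x = p x - q x) : combDist hP v = dist (convexComb hP p) (convexComb hP q) := by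
  have e : finsuppPosPart v + q = p + finsuppPosPart (-v) := by
    ext x
    simp only [finsuppPosPart, Finsupp.add_apply, Finsupp.mapRange_apply, Finsupp.neg_apply,
      NNReal.coe_add, Real.coe_toNNReal', h x]
    rcases le_total ((p x : ℝ) - q x) 0 with h0 | h0
    · rw [max_eq_right h0, max_eq_left (neg_nonneg.2 h0)]; ring
    · rw [max_eq_left h0, max_eq_right (neg_nonpos.2 h0)]; ring
  have e' := congrArg (convexComb hP) e
  rw [map_add, map_add] at e'
  rw [combDist, ← dist_add_right_of_mem_convexElements (z := convexComb hP q)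
    (convexComb_mem hP _) (convexComb_mem hP _), e', add_comm _ (convexComb hP q),
    dist_add_right_of_mem_convexElements (convexComb_mem hP _) (convexComb_mem hP _)]

theorem combDist_add_le {P : X → X} (hP : IsConvexifying P) (v w : X →₀ ℝ) :
    combDist hP (v + w) ≤ combDist hP v + combDist hP w := by
  rw [combDist_eq hP (p := finsuppPosPart v + finsuppPosPart w)
    (q := finsuppPosPart (-v) + finsuppPosPart (-w)) fun x => ?_, map_add, map_add]
  · exact dist_add_add_le_of_isLSpace _ _ _ _
  · rw [Finsupp.add_apply, finsuppPosPart_sub v, finsuppPosPart_sub w]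
    simp only [Finsupp.add_apply, NNReal.coe_add]
    ring

theorem combDist_smul {P : X → X} (hP : IsConvexifying P) {c : ℝ} (hc : 0 < c) (v : X →₀ ℝ) :
    combDist hP (c • v) = c * combDist hP v := by
  lift c to NNReal using hc.le
  rw [combDist_eq hP (p := c • finsuppPosPart v)
    (q := c • finsuppPosPart (-v)) fun x => ?_, convexComb_smul,
    convexComb_smul, IsLSpace.dist_smul, combDist]
  · rw [abs_of_pos hc]
  · rw [Finsupp.smul_apply, finsuppPosPart_sub v x]
    simp only [Finsupp.smul_apply, smul_eq_mul, NNReal.coe_mul]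
    ring

theorem combDist_single_sub {P : X → X} (hP : IsConvexifying P) (x y : X) :
    combDist hP (Finsupp.single x 1 - Finsupp.single y 1) = dist (P x) (P y) := by
  rw [combDist_eq hP (p := Finsupp.single x 1) (q := Finsupp.single y 1), convexComb_single,
    convexComb_single, NNReal.coe_one, one_smul, one_smul]
  intro z
  classical
  simp only [Finsupp.sub_apply, Finsupp.single_apply]
  split_ifs <;> simp

/-- Hahn-Banach theorem for `L`-spaces: the distance of convex elements is attained by an additive
positively homogeneous functional. -/
theorem IsConvexifying.exists_functional {P : X → X} (hP : IsConvexifying P) (x₀ y₀ : X) :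
    ∃ η : X → ℝ, (∀ x y, η (x + y) = η x + η y) ∧ (∀ c : ℝ, 0 ≤ c → ∀ x, η (c • x) = c * η x) ∧
      (∀ x y, |η x - η y| ≤ dist (P x) (P y)) ∧ η x₀ - η y₀ = dist (P x₀) (P y₀) := by
  obtain ⟨g, hg, hgv⟩ : ∃ g : (X →₀ ℝ) →ₗ[ℝ] ℝ, (∀ v, g v ≤ combDist hP v) ∧
      g (Finsupp.single x₀ 1 - Finsupp.single y₀ 1) = dist (P x₀) (P y₀) := by
    rw [← combDist_single_sub hP]
    set v₀ : X →₀ ℝ := Finsupp.single x₀ 1 - Finsupp.single y₀ 1 with hv₀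
    by_cases h0 : v₀ = 0
    · refine ⟨0, fun v => dist_nonneg, ?_⟩
      rw [h0, map_zero, combDist, neg_zero, dist_self]
    · obtain ⟨g, hg1, hg2⟩ := exists_extension_of_le_sublinear
        (LinearPMap.mkSpanSingleton v₀ (combDist hP v₀) h0) (combDist hP)
        (fun c hc v => combDist_smul hP hc v) (combDist_add_le hP) (by
          rintro ⟨v, hv⟩
          obtain ⟨c, rfl⟩ := Submodule.mem_span_singleton.1 hv
          rw [LinearPMap.mkSpanSingleton'_apply, RingHom.id_apply, smul_eq_mul]
          rcases lt_or_ge 0 c with hc | hc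
          · exact (combDist_smul hP hc v₀).ge
          · exact (mul_nonpos_of_nonpos_of_nonneg hc dist_nonneg).trans dist_nonneg)
      refine ⟨g, hg2, ?_⟩
      rw [hg1 ⟨v₀, Submodule.mem_span_singleton_self v₀⟩]
      exact LinearPMap.mkSpanSingleton_apply ℝ ℝ h0 _
  have hsub : ∀ x y, g (Finsupp.single x 1) - g (Finsupp.single y 1) ≤ dist (P x) (P y) := by
    intro x y
    rw [← map_sub, ← combDist_single_sub hP]
    exact hg _
  -- `combDist` is symmetric, so `g` vanishes wherever it does. The formal relations that express
  -- additivity and homogeneity of `η` have gauge zero.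
  have hzero : ∀ v : X →₀ ℝ, combDist hP v = 0 → g v = 0 := by
    intro v hv
    have h1 := hg v
    have h2 := hg (-v)
    have h3 : combDist hP (-v) = combDist hP v := by
      rw [combDist, combDist, neg_neg, dist_comm]
    rw [map_neg, h3] at h2
    linarith
  refine ⟨fun x => g (Finsupp.single x 1), fun x y => ?_, fun c hc x => ?_, fun x y => ?_, ?_⟩
  · have : g (Finsupp.single (x + y) 1 - (Finsupp.single x 1 + Finsupp.single y 1)) = 0 := by
      apply hzero
      rw [combDist_eq hP (p := Finsupp.single (x + y) 1)
        (q := Finsupp.single x 1 + Finsupp.single y 1), map_add, convexComb_single,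
        convexComb_single, convexComb_single]
      · simp [hP.apply_add]
      · intro z
        classical
        simp only [Finsupp.sub_apply, Finsupp.add_apply, Finsupp.single_apply, NNReal.coe_add]
        split_ifs <;> simp
    rw [map_sub, map_add] at this
    linarith
  · lift c to NNReal using hc
    have : g (Finsupp.single ((c : ℝ) • x) 1 - (c : ℝ) • Finsupp.single x 1) = 0 := by
      apply hzero
      rw [combDist_eq hP (p := Finsupp.single ((c : ℝ) • x) 1)
        (q := Finsupp.single x c), convexComb_single, convexComb_single]
      · simp [hP.apply_smul]
      · intro z
        classical
        simp only [Finsupp.sub_apply, Finsupp.smul_apply, Finsupp.single_apply]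
        split_ifs <;> simp
    rw [map_sub, map_smul, smul_eq_mul] at this
    linarith
  · rw [abs_le]
    refine ⟨?_, hsub x y⟩
    have := hsub y x
    rw [dist_comm] at this
    linarith
  · rw [← map_sub, hgv]

end LSpace

/-! ### Integration in `L`-spaces -/

theorem Measurable.exists_simpleFunc_near {u : ℝ → ℝ} (hu : Measurable u) {M : ℝ}
    (h0 : ∀ t, 0 ≤ u t) (hM : ∀ t, u t ≤ M) {δ : ℝ} (hδ : 0 < δ) :
    ∃ s : SimpleFunc ℝ ℝ, ∀ t, 0 ≤ s t ∧ s t ≤ u t ∧ u t ≤ s t + δ := by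
  refine ⟨⟨fun t => δ * ⌊u t / δ⌋₊, fun x => ?_, ?_⟩, fun t => ⟨?_, ?_, ?_⟩⟩
  · have : Measurable fun t => δ * (⌊u t / δ⌋₊ : ℝ) :=
      (measurable_from_top.comp (Nat.measurable_floor.comp (hu.div_const δ)) :
        Measurable fun t => (⌊u t / δ⌋₊ : ℝ)).const_mul δ
    exact this (measurableSet_singleton x)
  · apply ((Set.finite_Iic ⌊M / δ⌋₊).image fun n : ℕ => δ * (n : ℝ)).subset
    rintro _ ⟨t, rfl⟩
    exact ⟨⌊u t / δ⌋₊, Nat.floor_le_floor (by gcongr; exact hM t), rfl⟩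
  · change 0 ≤ δ * (⌊u t / δ⌋₊ : ℝ)
    positivity
  · change δ * (⌊u t / δ⌋₊ : ℝ) ≤ u t
    have := Nat.floor_le (div_nonneg (h0 t) hδ.le)
    rw [le_div_iff₀ hδ] at this
    linarith
  · change u t ≤ δ * (⌊u t / δ⌋₊ : ℝ) + δ
    have := Nat.lt_floor_add_one (u t / δ)
    rw [div_lt_iff₀ hδ] at this
    linarith

theorem integrable_comp_simpleFunc {X : Type*} (g : SimpleFunc ℝ X) (η : X → ℝ) (a b : ℝ) :
    IntegrableOn (fun t => η (g t)) (Icc a b) :=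
  (g.map η).integrable_of_isFiniteMeasure

section LSpace

variable {X : Type*} [AddCommMonoid X] [DistribMulAction ℝ X] [MetricSpace X]

/-- Functionals commute with the integral of simple mappings. -/
theorem IsConvexifying.functional_simpleLIntegral {P : X → X} (hP : IsConvexifying P) {η : X → ℝ}
    (hadd : ∀ x y, η (x + y) = η x + η y) (hsmul : ∀ c : ℝ, 0 ≤ c → ∀ x, η (c • x) = c * η x)
    (hdist : ∀ x y, |η x - η y| ≤ dist (P x) (P y)) (a b : ℝ) (g : SimpleFunc ℝ X) :
    η (simpleLIntegral P a b g) = ∫ t in Icc a b, η (g t) := by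
  classical
  have h0 : η 0 = 0 := by
    have := hsmul 0 le_rfl 0
    rwa [smul_zero, zero_mul] at this
  have hPη : ∀ x, η (P x) = η x := fun x => by
    have := hdist (P x) x
    rw [hP.idem, dist_self] at this
    exact sub_eq_zero.1 (abs_nonpos_iff.1 this)
  have hsum : ∀ (s : Finset X) (F : X → X), η (∑ x ∈ s, F x) = ∑ x ∈ s, η (F x) := by
    intro s F
    induction s using Finset.induction_on with
    | empty => simp [h0]
    | insert x s hx ih => rw [Finset.sum_insert hx, Finset.sum_insert hx, hadd, ih]
  have e1 : ∀ t, η (g t) = ∑ x ∈ g.range, (g ⁻¹' {x}).indicator (fun _ => η x) t := by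
    intro t
    rw [Finset.sum_eq_single (g t)]
    · rw [indicator_of_mem (by simp)]
    · intro x _ hx
      exact indicator_of_notMem (fun h => hx (Eq.symm h)) _
    · exact fun h => absurd (g.mem_range_self t) h
  rw [simpleLIntegral, hsum]
  simp only [e1]
  rw [integral_finsetSum]
  · apply Finset.sum_congr rfl
    intro x _
    rw [hsmul _ measureReal_nonneg, hPη, integral_indicator_const _ (g.measurableSet_fiber x),
      smul_eq_mul, measureReal_restrict_apply (g.measurableSet_fiber x)]
  · intro x _
    exact (integrable_const _).indicator (g.measurableSet_fiber x)

/-- Functionals commute with the integral. -/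
theorem HasLIntegral.functional_eq {P : X → X} (hP : IsConvexifying P) {a b : ℝ} (hab : a ≤ b)
    {f : ℝ → X} {I : X} (h : HasLIntegral P a b f I) {η : X → ℝ}
    (hadd : ∀ x y, η (x + y) = η x + η y) (hsmul : ∀ c : ℝ, 0 ≤ c → ∀ x, η (c • x) = c * η x)
    (hdist : ∀ x y, |η x - η y| ≤ dist (P x) (P y))
    (hint : IntegrableOn (fun t => η (f t)) (Icc a b)) : η I = ∫ t in Icc a b, η (f t) := by
  obtain ⟨g, hg, hgI⟩ := h
  have hηc : Continuous η := by
    refine (LipschitzWith.of_dist_le_mul (K := 1) fun x y => ?_).continuous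
    rw [NNReal.coe_one, one_mul]
    exact (hdist x y).trans (hP.dist_le x y)
  refine tendsto_nhds_unique ((hηc.tendsto I).comp hgI) ?_
  rw [Metric.tendsto_nhds]
  intro ε hε
  -- The summand `1` keeps the denominator positive when `a = b` and makes the final inequality
  -- strict.
  have hε' : 0 < ε / (b - a + 1) := by
    have : 0 ≤ b - a := sub_nonneg.2 hab
    positivity
  filter_upwards [hg _ hε'] with n hn
  simp only [Function.comp]
  rw [hP.functional_simpleLIntegral hadd hsmul hdist, Real.dist_eq,
    ← integral_sub (integrable_comp_simpleFunc _ _ _ _) hint]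
  have h1 : ‖∫ t in Icc a b, (η (g n t) - η (f t))‖ ≤ ε / (b - a + 1) * volume.real (Icc a b) := by
    apply norm_setIntegral_le_of_norm_le_const_ae (by simp)
    filter_upwards [hn] with t ht
    exact (hdist _ _).trans ht
  rw [Real.norm_eq_abs, Real.volume_real_Icc_of_le hab] at h1
  refine h1.trans_lt ?_
  have : 0 ≤ b - a := sub_nonneg.2 hab
  rw [div_mul_eq_mul_div, div_lt_iff₀ (by positivity)]
  nlinarith

variable [IsLSpace X]

theorem IsConvexifying.apply_simpleLIntegral {P : X → X} (hP : IsConvexifying P) (a b : ℝ)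
    (g : SimpleFunc ℝ X) : P (simpleLIntegral P a b g) = simpleLIntegral P a b g := by
  classical
  have hsum : ∀ (s : Finset X) (F : X → X), P (∑ x ∈ s, F x) = ∑ x ∈ s, P (F x) := by
    intro s F
    induction s using Finset.induction_on with
    | empty => simp [hP.apply_zero]
    | insert x s hx ih => rw [Finset.sum_insert hx, Finset.sum_insert hx, hP.apply_add, ih]
  rw [simpleLIntegral, hsum]
  exact Finset.sum_congr rfl fun x _ => by rw [hP.apply_smul, hP.idem]

/-- Integrals of simple mappings are fixed by the continuous map `P`, hence so are their limits.
Thus a functional attaining `dist (P I) (P J)` attains the distance of the integrals themselves. -/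
theorem HasLIntegral.apply_eq {P : X → X} (hP : IsConvexifying P) {a b : ℝ} {f : ℝ → X} {I : X}
    (h : HasLIntegral P a b f I) : P I = I := by
  obtain ⟨g, -, hg⟩ := h
  refine tendsto_nhds_unique ((hP.continuous.tendsto I).comp hg) ?_
  simpa only [Function.comp_def, hP.apply_simpleLIntegral] using hg

/-- A functional attaining the distance between two integrals of simple mappings reduces it to a
real integral, where uniform closeness gives the Cauchy property; completeness supplies the limit.
-/
theorem IsConvexifying.lIntegrable_of_approx {P : X → X} (hP : IsConvexifying P) {a b : ℝ}
    (hab : a ≤ b) {f : ℝ → X}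
    (h : ∀ ε : ℝ, 0 < ε → ∃ g : SimpleFunc ℝ X, ∀ᵐ t ∂(volume.restrict (Icc a b)),
      dist (P (g t)) (P (f t)) ≤ ε) : LIntegrable P a b f := by
  have hpos : ∀ n : ℕ, (0 : ℝ) < 1 / ((n : ℝ) + 1) := fun n => Nat.one_div_pos_of_nat
  choose g hg using fun n : ℕ => h _ (hpos n)
  have hanti : ∀ {m n : ℕ}, m ≤ n → 1 / ((n : ℝ) + 1) ≤ 1 / ((m : ℝ) + 1) := fun hmn =>
    Nat.one_div_le_one_div hmn
  have hcauchy : CauchySeq fun n => simpleLIntegral P a b (g n) := by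
    refine cauchySeq_of_le_tendsto_0 (fun N : ℕ => 2 * (1 / ((N : ℝ) + 1)) * (b - a)) ?_ ?_
    · intro n m N hn hm
      obtain ⟨η, hadd, hsmul, hdist, hη⟩ :=
        hP.exists_functional (simpleLIntegral P a b (g n)) (simpleLIntegral P a b (g m))
      rw [hP.apply_simpleLIntegral, hP.apply_simpleLIntegral,
        hP.functional_simpleLIntegral hadd hsmul hdist,
        hP.functional_simpleLIntegral hadd hsmul hdist,
        ← integral_sub (integrable_comp_simpleFunc _ _ _ _)
          (integrable_comp_simpleFunc _ _ _ _)] at hη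
      rw [← hη]
      have h1 : ‖∫ t in Icc a b, (η (g n t) - η (g m t))‖ ≤
          2 * (1 / ((N : ℝ) + 1)) * volume.real (Icc a b) := by
        apply norm_setIntegral_le_of_norm_le_const_ae (by simp)
        filter_upwards [hg n, hg m] with t h2 h3
        refine (hdist _ _).trans ((dist_triangle_right _ _ (P (f t))).trans ?_)
        linarith [hanti hn, hanti hm]
      rw [Real.volume_real_Icc_of_le hab] at h1
      exact (le_abs_self _).trans h1
    · have := (tendsto_one_div_add_atTop_nhds_zero_nat (𝕜 := ℝ)).const_mul 2
      simpa using this.mul_const (b - a)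
  have : CompleteSpace X := IsLSpace.complete
  obtain ⟨I, hI⟩ := cauchySeq_tendsto_of_complete hcauchy
  refine ⟨I, g, fun ε hε => ?_, hI⟩
  have hev : ∀ᶠ n : ℕ in atTop, 1 / ((n : ℝ) + 1) < ε :=
    (tendsto_one_div_add_atTop_nhds_zero_nat (𝕜 := ℝ)).eventually_lt_const hε
  filter_upwards [hev] with n hn
  filter_upwards [hg n] with t ht using ht.trans hn.le

/-- Rounding the weight down costs at most `δ * D`, where `D` bounds the distance of `P (f t)` from
zero. Rounding the argument costs at most `M * ω δ`. -/
theorem IsConvexifying.lIntegrable_smul {P : X → X} (hP : IsConvexifying P) {a b : ℝ} (hab : a ≤ b)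
    {ω : ℝ → ℝ} (hω : IsModulusOfContinuity ω) {ψ : ℝ → ℝ} (hψ : IsBoundedMeasurable a b ψ)
    (hψ0 : ∀ᵐ t ∂(volume.restrict (Icc a b)), 0 ≤ ψ t) {f : ℝ → X} (hf : f ∈ classH ω a b) :
    LIntegrable P a b fun t => ψ t • f t := by
  apply hP.lIntegrable_of_approx hab
  intro ε hε
  obtain ⟨M, hM⟩ := hψ.bounded
  have hM0 : 0 ≤ M := (abs_nonneg _).trans (hM a ⟨le_rfl, hab⟩)
  have haI : a ∈ Icc a b := ⟨le_rfl, hab⟩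
  set D := ω (b - a) + dist (P (f a)) 0
  have hDf : ∀ t ∈ Icc a b, dist (P (f t)) 0 ≤ D := by
    intro t ht
    refine (dist_triangle _ (P (f a)) _).trans (add_le_add ?_ le_rfl)
    refine (hP.dist_le _ _).trans ((hf t ht a haI).trans ?_)
    rw [abs_of_nonneg (sub_nonneg.2 ht.1)]
    exact hω.monotoneOn (sub_nonneg.2 ht.1) (sub_nonneg.2 hab) (by linarith [ht.2])
  obtain ⟨δ, hδ, hδω⟩ : ∃ δ : ℝ, 0 < δ ∧ M * ω δ + δ * D ≤ ε := by
    have h1 : Tendsto (fun δ => M * ω δ + δ * D) (𝓝[>] 0) (𝓝 (M * ω 0 + 0 * D)) := by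
      have h2 : Tendsto ω (𝓝[>] 0) (𝓝 (ω 0)) :=
        (hω.continuousOn 0 (mem_Ici.2 le_rfl)).mono_left (nhdsWithin_mono _ Ioi_subset_Ici_self)
      exact (h2.const_mul M).add ((tendsto_id.mono_left nhdsWithin_le_nhds).mul_const D)
    rw [hω.map_zero, mul_zero, zero_mul, add_zero] at h1
    obtain ⟨δ, h2, h3⟩ := ((h1.eventually_lt_const hε).and self_mem_nhdsWithin).exists
    exact ⟨δ, h3, h2.le⟩
  -- Truncating a measurable version of `ψ` to `[0, M]` makes the bounds hold everywhere and changes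
  -- nothing almost everywhere on the segment.
  set u : ℝ → ℝ := fun t => max 0 (min M (hψ.aemeasurable.mk ψ t)) with hu
  have hum : Measurable u :=
    measurable_const.max (measurable_const.min hψ.aemeasurable.measurable_mk)
  obtain ⟨s, hs⟩ := hum.exists_simpleFunc_near (M := M) (fun t => le_max_left _ _)
    (fun t => max_le hM0 (min_le_left _ _)) hδ
  have hvm : Measurable fun t : ℝ => max a (min b t) - a := by fun_prop
  obtain ⟨q, hq⟩ := hvm.exists_simpleFunc_near (M := b - a)
    (fun t => sub_nonneg.2 (le_max_left _ _))
    (fun t => sub_le_sub_right (max_le hab (min_le_left _ _)) a) hδ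
  -- Since `q` rounds `t - a` down, the sampling point `a + q t` remains in `[a, b]`.
  refine ⟨(SimpleFunc.pair s q).map fun p => p.1 • f (a + p.2), ?_⟩
  filter_upwards [ae_restrict_mem measurableSet_Icc, hψ.aemeasurable.ae_eq_mk, hψ0] with t ht hmk h0
  have hut : u t = ψ t := by
    rw [hu]
    simp only
    rw [← hmk, min_eq_right ((le_abs_self _).trans (hM t ht)), max_eq_right h0]
  obtain ⟨hs0, hs1, hs2⟩ := hs t
  rw [hut] at hs1 hs2
  obtain ⟨hq0, hq1, hq2⟩ := hq t
  rw [min_eq_right ht.2, max_eq_right ht.1] at hq1 hq2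
  have hτ : a + q t ∈ Icc a b := ⟨by linarith, by linarith [ht.2]⟩
  simp only [SimpleFunc.map_apply, SimpleFunc.pair_apply]
  rw [hP.apply_smul, hP.apply_smul]
  have h1 : dist (s t • P (f (a + q t))) (s t • P (f t)) ≤ M * ω δ := by
    rw [IsLSpace.dist_smul, abs_of_nonneg hs0]
    apply mul_le_mul (hs1.trans ((le_abs_self _).trans (hM t ht))) _ dist_nonneg hM0
    refine (hP.dist_le _ _).trans ((hf _ hτ t ht).trans ?_)
    apply hω.monotoneOn (mem_Ici.2 (abs_nonneg _)) hδ.le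
    rw [abs_le]
    constructor <;> linarith
  have h2 : dist (s t • P (f t)) (ψ t • P (f t)) ≤ δ * D := by
    refine (dist_smul_smul_of_mem_convexElements (hP.apply_mem _) hs0 hs1).trans ?_
    exact mul_le_mul (by linarith) (hDf t ht) dist_nonneg hδ.le
  exact (dist_triangle _ _ _).trans ((add_le_add h1 h2).trans hδω)

end LSpace

/-! ### Reduction to real functions and conclusion -/

theorem IsBoundedMeasurable.intervalIntegrable {a b : ℝ} {ψ : ℝ → ℝ} (hab : a ≤ b)
    (h : IsBoundedMeasurable a b ψ) : IntervalIntegrable ψ volume a b := by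
  obtain ⟨M, hM⟩ := h.bounded
  rw [intervalIntegrable_iff_integrableOn_Icc_of_le hab]
  refine Integrable.of_bound h.aemeasurable.aestronglyMeasurable M ?_
  filter_upwards [ae_restrict_mem measurableSet_Icc] with t ht using hM t ht

/-- A functional `η` attaining the distance of the two integrals replaces `f` by the real function
`η ∘ f`. As `η` is homogeneous only for non-negative scalars, each non-negative weight is pulled out
separately before subtracting. -/
theorem IsConvexifying.functionalS_le {X : Type*} [AddCommMonoid X] [DistribMulAction ℝ X]
    [MetricSpace X] [IsLSpace X] {P : X → X} (hP : IsConvexifying P) {a b : ℝ} (hab : a ≤ b)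
    {ω : ℝ → ℝ} (hω : IsModulusOfContinuity ω) {ψ₁ ψ₂ : ℝ → ℝ}
    (hψ₁ : IsBoundedMeasurable a b ψ₁) (hψ₂ : IsBoundedMeasurable a b ψ₂)
    (hψ₁_nonneg : ∀ᵐ t ∂(volume.restrict (Icc a b)), 0 ≤ ψ₁ t)
    (hψ₂_nonneg : ∀ᵐ t ∂(volume.restrict (Icc a b)), 0 ≤ ψ₂ t) {C : ℝ}
    (hC : ∀ f : ℝ → ℝ, (∀ s ∈ Icc a b, ∀ t ∈ Icc a b, |f s - f t| ≤ ω |s - t|) →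
      ∫ t in a..b, f t * (ψ₁ t - ψ₂ t) ≤ C) :
    functionalS P ω a b ψ₁ ψ₂ ≤ ENNReal.ofReal C := by
  refine iSup₂_le fun f hf => ?_
  have hI : ∀ ψ : ℝ → ℝ, LIntegrable P a b (fun t => ψ t • f t) →
      HasLIntegral P a b (fun t => ψ t • f t) (lIntegral P a b fun t => ψ t • f t) := by
    intro ψ h
    rw [lIntegral, dif_pos h]
    exact h.choose_spec
  have h1 := hI ψ₁ (hP.lIntegrable_smul hab hω hψ₁ hψ₁_nonneg hf)
  have h2 := hI ψ₂ (hP.lIntegrable_smul hab hω hψ₂ hψ₂_nonneg hf)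
  obtain ⟨η, hadd, hsmul, hdist, hη⟩ := hP.exists_functional
    (lIntegral P a b fun t => ψ₁ t • f t) (lIntegral P a b fun t => ψ₂ t • f t)
  rw [h1.apply_eq hP, h2.apply_eq hP] at hη
  have hηf : ∀ s ∈ Icc a b, ∀ t ∈ Icc a b, |η (f s) - η (f t)| ≤ ω |s - t| := fun s hs t ht =>
    (hdist _ _).trans ((hP.dist_le _ _).trans (hf s hs t ht))
  have hηc : ContinuousOn (fun t => η (f t)) (Icc a b) := hω.continuousOn_of_dist_le hηf
  have hint : ∀ ψ : ℝ → ℝ, IsBoundedMeasurable a b ψ →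
      IntervalIntegrable (fun t => η (f t) * ψ t) volume a b := fun ψ h =>
    (h.intervalIntegrable hab).continuousOn_mul (by rwa [uIcc_of_le hab])
  have hval : ∀ (ψ : ℝ → ℝ) (I : X), IsBoundedMeasurable a b ψ →
      (∀ᵐ t ∂(volume.restrict (Icc a b)), 0 ≤ ψ t) → HasLIntegral P a b (fun t => ψ t • f t) I →
      η I = ∫ t in a..b, η (f t) * ψ t := by
    intro ψ I h h0 hI
    have hae : (fun t => η (ψ t • f t)) =ᵐ[volume.restrict (Icc a b)] fun t => η (f t) * ψ t := by
      filter_upwards [h0] with t ht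
      rw [hsmul _ ht, mul_comm]
    rw [hI.functional_eq hP hab hadd hsmul hdist, integral_congr_ae hae,
      intervalIntegral.integral_of_le hab, integral_Icc_eq_integral_Ioc]
    exact ((intervalIntegrable_iff_integrableOn_Icc_of_le hab).1 (hint ψ h)).congr hae.symm
  rw [hval ψ₁ _ hψ₁ hψ₁_nonneg h1, hval ψ₂ _ hψ₂ hψ₂_nonneg h2,
    ← intervalIntegral.integral_sub (hint ψ₁ hψ₁) (hint ψ₂ hψ₂)] at hη
  rw [edist_dist, ← hη]
  apply ENNReal.ofReal_le_ofReal
  refine le_trans (le_of_eq ?_) (hC _ hηf)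
  simp only [mul_sub]

theorem mainTheorem2 {X : Type*} [AddCommMonoid X] [DistribMulAction ℝ X] [MetricSpace X]
    [IsLSpace X] (P : X → X) (hP : IsConvexifying P)
    (a b : ℝ) (hab : a < b)
    (ω : ℝ → ℝ) (hω : IsModulusOfContinuity ω) (hω_concave : ConcaveOn ℝ (Ici 0) ω)
    (ψ₁ ψ₂ : ℝ → ℝ) (hψ₁ : IsBoundedMeasurable a b ψ₁) (hψ₂ : IsBoundedMeasurable a b ψ₂)
    (hψ₁_nonneg : ∀ᵐ t ∂(volume.restrict (Icc a b)), 0 ≤ ψ₁ t)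
    (hψ₂_nonneg : ∀ᵐ t ∂(volume.restrict (Icc a b)), 0 ≤ ψ₂ t)
    (hD : IsD0 a b (fun t => ψ₁ t - ψ₂ t))
    (Ψ : ℝ → ℝ) (hΨ : ∀ t ∈ Icc a b, Ψ t = ∫ u in a..t, (ψ₁ u - ψ₂ u)) :
    (∀ f ∈ (classH ω a b : Set (ℝ → X)),
      LIntegrable P a b (fun t => ψ₁ t • f t) ∧ LIntegrable P a b (fun t => ψ₂ t • f t)) ∧
    (∃ (ι : Type) (_ : Countable ι) (φ : ι → ℝ → ℝ), IsSigmaRepresentation a b Ψ φ) ∧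
    (∀ (ι : Type) [Countable ι] (φ : ι → ℝ → ℝ), IsSigmaRepresentation a b Ψ φ →
      functionalS P ω a b ψ₁ ψ₂ ≤
        ENNReal.ofReal (∫ t in (0 : ℝ)..(b - a), |deriv (sigmaRearrangement a b φ) t| * ω t)) := by
  have hψ : IntervalIntegrable (fun t => ψ₁ t - ψ₂ t) volume a b :=
    (hψ₁.intervalIntegrable hab.le).sub (hψ₂.intervalIntegrable hab.le)
  obtain ⟨M₁, hM₁⟩ := hψ₁.bounded
  obtain ⟨M₂, hM₂⟩ := hψ₂.bounded
  have hM : ∀ t ∈ Icc a b, |ψ₁ t - ψ₂ t| ≤ M₁ + M₂ := fun t ht =>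
    (abs_sub _ _).trans (add_le_add (hM₁ t ht) (hM₂ t ht))
  refine ⟨fun f hf => ⟨hP.lIntegrable_smul hab.le hω hψ₁ hψ₁_nonneg hf,
    hP.lIntegrable_smul hab.le hω hψ₂ hψ₂_nonneg hf⟩,
    exists_isSigmaRepresentation hab hψ hM hD hΨ, fun ι _ φ hφ => ?_⟩
  exact hP.functionalS_le hab.le hω hψ₁ hψ₂ hψ₁_nonneg hψ₂_nonneg fun f hf =>
    hφ.integral_mul_le hab hψ hM hΨ hω hf
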